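/- Let $\mathfrak g_{\mathbb C}$ be a finite-dimensional contragredient complex Lie superalgebra with Cartan subalgebra $\mathfrak h_{\mathbb C}$ (self-centralizing, contained in the even part, acting diagonalizably): it is generated by $\mathfrak h_{\mathbb C}$ and homogeneous $e_i,f_i$ ($1\le i\le n$) with $[e_i,f_j]=\delta_{ij}h_i$, $[H,e_i]=\alpha_i(H)e_i$, $[H,f_i]=-\alpha_i(H)f_i$ for $H\in\mathfrak h_{\mathbb C}$, where the $h_i\in\mathfrak h_{\mathbb C}$ are linearly independent, and no nonzero graded ideal meets $\mathfrak h_{\mathbb C}$ trivially. Let $\mathfrak g$ be a real form of $\mathfrak g_{\mathbb C}$ with Cartan decomposition $\mathfrak g=\mathfrak k\oplus\mathfrak p$, $\mathfrak p=\mathfrak p_0\oplus\mathfrak g_1$; that is, $\mathfrak g_0=\mathfrak k\oplus\mathfrak p_0$ is a $\mathbb Z/2$-graded Lie algebra (with $\mathfrak k$ in degree $0$), and for some inner product on $\mathfrak g$ the operators $\operatorname{ad}X$ are skew-symmetric for $X\in\mathfrak k$ and symmetric for $X\in\mathfrak p_0$. Suppose that $\mathfrak g$ has equal rank, i.e. $\mathfrak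 h_{\mathbb C}\subset\mathfrak k_{\mathbb C}$ is the complexification of $\mathfrak h=\mathfrak h_{\mathbb C}\cap\mathfrak k$, and that $\mathfrak k_{\mathbb C}$ has non-trivial center. Let $P$ be a positive system of roots of $(\mathfrak g_{\mathbb C},\mathfrak h_{\mathbb C})$, i.e. the set of roots on which some real linear functional on $\mathfrak h_{\mathbb C}^*$ that vanishes on no root is positive. Let $a\mapsto a^*$ be the conjugate linear map of $\mathcal U(\mathfrak g_{\mathbb C})$ with $(ab)^*=(-1)^{|a||b|}b^*a^*$ for homogeneous $a,b$ and $X^*=-(-1)^{|X|}X$ for homogeneous $X\in\mathfrak g$. For $\mu\in\mathfrak h_{\mathbb C}^*$ let $\mathcal U[\mu]=\{a\in\mathcal U(\mathfrak g_{\mathbb C}): [H,a]=\mu(H)a\ \forall H\in\mathfrak h_{\mathbb C}\}$, and let $\beta:\mathcal U(\mathfrak g_{\mathbb C})\to\mathcal U(\mathfrak h_{\mathbb C})=S(\mathfrak h_{\mathbb C})$ be the Harish-Chandra map: the linear map that vanishes on $\mathcal U[\mu]$ for $\mu\neq0$ and satisfies $u\equiv\beta(u)$ modulo $\sum_{\gamma\in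 P}\mathcal U(\mathfrak g_{\mathbb C})\mathfrak g_\gamma$ for $u\in\mathcal U[0]$. A representation $\pi$ of $\mathfrak g_{\mathbb C}$ on a complex super vector space $V$ is unitary if there is a sesquilinear form $(\cdot,\cdot)$ on $V$, linear in the first and antilinear in the second argument, with $(u,w)=(-1)^{|u||w|}\overline{(w,u)}$ for homogeneous $u,w$ and $(u,w)=0$ if $|u|\ne|w|$, such that $(\cdot,\cdot)$ is positive definite on $V_0$, $i(\cdot,\cdot)$ is positive definite on $V_1$, and $(\pi(X)u,w)=(-1)^{|u||X|}(u,\pi(X^*)w)$ for all homogeneous $X\in\mathfrak g$, homogeneous $u\in V$ and all $w\in V$. Let $\lambda\in\mathfrak h_{\mathbb C}^*$, and let $\pi_\lambda$ be the irreducible highest weight representation of highest weight $\lambda$ with respect to $P$, with homogeneous highest weight vector $v$. Then the following are equivalent: (1) $\pi_\lambda$ is unitary; (2) $(-i)^{|a|}\beta(a^*a)(\lambda)\ge0$ for all homogeneous $a\in\mathcal U(\mathfrak g_{\mathbb C})$; (3) $(-i)^{|a|}\beta(a^*a)(\lambda)>0$ for all homogeneous $a\in\mathcal U(\mathfrak g_{\mathbb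 C})$ with $\pi_\lambda(a)v\ne0$. In particular, if $\pi_\lambda$ is unitary, then $\lambda(H_\alpha)\ge0$ for every compact root $\alpha\in P$ (that is, $\mathfrak g_\alpha\subset\mathfrak k_{\mathbb C}$), and $\lambda(H_\alpha)\le0$ for every non-compact even root $\alpha\in P$ (that is, $\mathfrak g_\alpha\subset(\mathfrak p_0)_{\mathbb C}$), where $H_\alpha\in[\mathfrak g_\alpha,\mathfrak g_{-\alpha}]$ is the coroot, $\alpha(H_\alpha)=2$. -/

import Mathlib

open scoped ComplexOrder

namespace SuperHC

noncomputable section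

/-! ### Lie superalgebras -/

/-- The sign `(-1)^(ij)` of the rule of signs. -/
def sgn (i j : ZMod 2) : ℂ := (-1) ^ (i.val * j.val)

/-- A complex Lie superalgebra: `L = L₀ ⊕ L₁` with an even super-antisymmetric bracket satisfying
the super Jacobi identity. -/
class LieSuperalgebra (L : Type*) [AddCommGroup L] [Module ℂ L] where
  part : ZMod 2 → Submodule ℂ L
  isCompl_part : IsCompl (part 0) (part 1)
  bracket : L →ₗ[ℂ] L →ₗ[ℂ] L
  bracket_mem : ∀ {i j : ZMod 2} {x y : L}, x ∈ part i → y ∈ part j → bracket x y ∈ part (i + j)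
  skew : ∀ {i j : ZMod 2} {x y : L}, x ∈ part i → y ∈ part j →
    bracket x y = -(sgn i j • bracket y x)
  jacobi : ∀ {i j : ZMod 2} {x y : L} (z : L), x ∈ part i → y ∈ part j →
    bracket x (bracket y z) = bracket (bracket x y) z + sgn i j • bracket y (bracket x z)

open LieSuperalgebra

section Enveloping

variable (L : Type*) [AddCommGroup L] [Module ℂ L] [LieSuperalgebra L]

/-- The projection of a Lie superalgebra onto its even part. -/
def proj0 : L →ₗ[ℂ] L := (part 0 : Submodule ℂ L).projection (part 1) isCompl_part

/-- The projection of a Lie superalgebra onto its odd part. -/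
def proj1 : L →ₗ[ℂ] L := (part 1 : Submodule ℂ L).projection (part 0) isCompl_part.symm

variable {L}

theorem proj0_even {x : L} (hx : x ∈ (part 0 : Submodule ℂ L)) : proj0 L x = x :=
  Submodule.projection_apply_of_mem_left _ hx

theorem proj0_odd {x : L} (hx : x ∈ (part 1 : Submodule ℂ L)) : proj0 L x = 0 :=
  Submodule.projection_apply_of_mem_right _ hx

theorem proj1_even {x : L} (hx : x ∈ (part 0 : Submodule ℂ L)) : proj1 L x = 0 :=
  Submodule.projection_apply_of_mem_right _ hx

theorem proj1_odd {x : L} (hx : x ∈ (part 1 : Submodule ℂ L)) : proj1 L x = x :=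
  Submodule.projection_apply_of_mem_left _ hx

theorem zmod_two_cases (i : ZMod 2) : i = 0 ∨ i = 1 := by
  revert i; decide

/-- The relations `x y - (-1)^(|x||y|) y x = [x, y]` of the enveloping algebra. -/
inductive URel : TensorAlgebra ℂ L → TensorAlgebra ℂ L → Prop
  | mk {i j : ZMod 2} {x y : L} (hx : x ∈ (part i : Submodule ℂ L))
      (hy : y ∈ (part j : Submodule ℂ L)) :
      URel (TensorAlgebra.ι ℂ x * TensorAlgebra.ι ℂ y
          - sgn i j • (TensorAlgebra.ι ℂ y * TensorAlgebra.ι ℂ x))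
        (TensorAlgebra.ι ℂ (bracket x y))

variable (L) in
/-- The universal enveloping algebra of a Lie superalgebra. -/
def U : Type _ := RingQuot (URel (L := L))

instance : Ring (U L) := inferInstanceAs (Ring (RingQuot (URel (L := L))))

instance : Algebra ℂ (U L) := inferInstanceAs (Algebra ℂ (RingQuot (URel (L := L))))

variable (L) in
/-- The canonical map of a Lie superalgebra to its enveloping algebra. -/
def ι : L →ₗ[ℂ] U L :=
  (RingQuot.mkAlgHom ℂ (URel (L := L))).toLinearMap ∘ₗ TensorAlgebra.ι ℂ

theorem ι_mul_ι {i j : ZMod 2} {x y : L} (hx : x ∈ (part i : Submodule ℂ L))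
    (hy : y ∈ (part j : Submodule ℂ L)) :
    ι L x * ι L y - sgn i j • (ι L y * ι L x) = ι L (bracket x y) := by
  have h := RingQuot.mkAlgHom_rel ℂ (URel.mk hx hy)
  rw [map_sub, map_smul, map_mul, map_mul] at h
  exact h

/-- The universal property of the enveloping algebra. -/
def lift {A : Type*} [Ring A] [Algebra ℂ A] (φ : L →ₗ[ℂ] A)
    (hφ : ∀ {i j : ZMod 2} {x y : L}, x ∈ (part i : Submodule ℂ L) →
      y ∈ (part j : Submodule ℂ L) → φ x * φ y - sgn i j • (φ y * φ x) = φ (bracket x y)) :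
    U L →ₐ[ℂ] A :=
  RingQuot.liftAlgHom ℂ ⟨TensorAlgebra.lift ℂ φ, by
    intro a b hab
    obtain ⟨hx, hy⟩ := hab
    simpa using hφ hx hy⟩

theorem lift_ι {A : Type*} [Ring A] [Algebra ℂ A] (φ : L →ₗ[ℂ] A)
    (hφ : ∀ {i j : ZMod 2} {x y : L}, x ∈ (part i : Submodule ℂ L) →
      y ∈ (part j : Submodule ℂ L) → φ x * φ y - sgn i j • (φ y * φ x) = φ (bracket x y))
    (x : L) : lift φ hφ (ι L x) = φ x := by
  have h := RingQuot.liftAlgHom_mkAlgHom_apply (S := ℂ) (s := URel (L := L))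
    (TensorAlgebra.lift ℂ φ) (by
      intro a b hab
      obtain ⟨hx, hy⟩ := hab
      simpa using hφ hx hy) (TensorAlgebra.ι ℂ x)
  rw [TensorAlgebra.lift_ι_apply] at h
  exact h

theorem U_induction {C : U L → Prop} (hι : ∀ x, C (ι L x)) (hc : ∀ c : ℂ, C (algebraMap ℂ (U L) c))
    (hmul : ∀ a b, C a → C b → C (a * b)) (hadd : ∀ a b, C a → C b → C (a + b)) (u : U L) : C u := by
  obtain ⟨t, rfl⟩ := RingQuot.mkAlgHom_surjective ℂ (URel (L := L)) u
  induction t using TensorAlgebra.induction with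
  | algebraMap r => rw [AlgHom.commutes]; exact hc r
  | ι x => exact hι x
  | mul a b ha hb => rw [map_mul]; exact hmul _ _ ha hb
  | add a b ha hb => rw [map_add]; exact hadd _ _ ha hb

theorem parity_rel {i j : ZMod 2} {x y : L} (hx : x ∈ (part i : Submodule ℂ L))
    (hy : y ∈ (part j : Submodule ℂ L)) :
    (ι L ∘ₗ (proj0 L - proj1 L)) x * (ι L ∘ₗ (proj0 L - proj1 L)) y
        - sgn i j • ((ι L ∘ₗ (proj0 L - proj1 L)) y * (ι L ∘ₗ (proj0 L - proj1 L)) x)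
      = (ι L ∘ₗ (proj0 L - proj1 L)) (bracket x y) := by
  have hxy := bracket_mem hx hy
  have h := ι_mul_ι hx hy
  rcases zmod_two_cases i with rfl | rfl <;> rcases zmod_two_cases j with rfl | rfl
  · simp only [add_zero] at hxy
    simpa [proj0_even hx, proj1_even hx, proj0_even hy, proj1_even hy, proj0_even hxy,
      proj1_even hxy] using h
  · simp only [zero_add] at hxy
    simp only [LinearMap.comp_apply, LinearMap.sub_apply, proj0_even hx, proj1_even hx,
      proj0_odd hy, proj1_odd hy, proj0_odd hxy, proj1_odd hxy, sub_zero, zero_sub, map_neg,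
      mul_neg, neg_mul, smul_neg, ← h]
    abel
  · simp only [add_zero] at hxy
    simp only [LinearMap.comp_apply, LinearMap.sub_apply, proj0_even hy, proj1_even hy,
      proj0_odd hx, proj1_odd hx, proj0_odd hxy, proj1_odd hxy, sub_zero, zero_sub, map_neg,
      mul_neg, neg_mul, smul_neg, ← h]
    abel
  · have e : (1 + 1 : ZMod 2) = 0 := by decide
    rw [e] at hxy
    simpa [proj0_odd hx, proj1_odd hx, proj0_odd hy, proj1_odd hy, proj0_even hxy,
      proj1_even hxy] using h

variable (L) in
/-- The parity automorphism of the enveloping algebra: the automorphism that is `1` on `L₀`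
and `-1` on `L₁`. -/
def parity : U L →ₐ[ℂ] U L := lift (ι L ∘ₗ (proj0 L - proj1 L)) parity_rel

theorem parity_ι (x : L) : parity L (ι L x) = ι L (proj0 L x - proj1 L x) :=
  lift_ι (ι L ∘ₗ (proj0 L - proj1 L)) parity_rel x

/-- The elements of the enveloping algebra that are homogeneous of parity `i`. -/
def homogeneous (i : ZMod 2) : Submodule ℂ (U L) where
  carrier := {u | parity L u = (-1 : ℂ) ^ i.val • u}
  add_mem' := by
    intro a b ha hb
    simp only [Set.mem_ofPred_eq] at *
    rw [map_add, ha, hb, smul_add]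
  zero_mem' := by simp
  smul_mem' := by
    intro c a ha
    simp only [Set.mem_ofPred_eq] at *
    rw [map_smul, ha, smul_comm]

theorem ι_mem_homogeneous {i : ZMod 2} {x : L} (hx : x ∈ (part i : Submodule ℂ L)) :
    ι L x ∈ homogeneous (L := L) i := by
  change parity L (ι L x) = _
  rw [parity_ι]
  rcases zmod_two_cases i with rfl | rfl
  · simp [proj0_even hx, proj1_even hx]
  · simp [proj0_odd hx, proj1_odd hx, ZMod.val_one]

end Enveloping

/-! ### Real forms and the adjoint -/

section Real

variable (L : Type*) [AddCommGroup L] [Module ℂ L] [LieSuperalgebra L]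

/-- A real form of a complex Lie superalgebra, given by its complex conjugation. -/
structure RealForm where
  conj : L →ₛₗ[starRingEnd ℂ] L
  conj_conj : ∀ x, conj (conj x) = x
  conj_mem : ∀ {i : ZMod 2} {x : L}, x ∈ (part i : Submodule ℂ L) →
    conj x ∈ (part i : Submodule ℂ L)
  conj_bracket : ∀ x y : L, conj (bracket x y) = bracket (conj x) (conj y)

variable {L}

/-- The real Lie superalgebra itself: the fixed points of the conjugation. -/
def RealForm.carrier (σ : RealForm L) : Submodule ℝ L where
  carrier := {x | σ.conj x = x}
  add_mem' := by
    intro a b ha hb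
    simp only [Set.mem_ofPred_eq] at *
    rw [map_add, ha, hb]
  zero_mem' := by simp
  smul_mem' := by
    intro c a ha
    simp only [Set.mem_ofPred_eq] at *
    rw [← Complex.coe_smul, map_smulₛₗ, ha, Complex.conj_ofReal]

/-- The even part of the real form. -/
def RealForm.even (σ : RealForm L) : Submodule ℝ L :=
  σ.carrier ⊓ (part 0 : Submodule ℂ L).restrictScalars ℝ

/-- The opposite of a complex algebra, with the conjugate scalar multiplication. -/
def ConjOp (A : Type*) : Type _ := Aᵐᵒᵖ

instance (A : Type*) [Ring A] : Ring (ConjOp A) := inferInstanceAs (Ring Aᵐᵒᵖ)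

instance (A : Type*) [Ring A] [Algebra ℂ A] : Algebra ℂ (ConjOp A) :=
  Algebra.compHom Aᵐᵒᵖ (starRingEnd ℂ)

/-- The tautological map to the conjugate opposite algebra. -/
def ConjOp.mk {A : Type*} (a : A) : ConjOp A := MulOpposite.op a

/-- The tautological map from the conjugate opposite algebra. -/
def ConjOp.out {A : Type*} (a : ConjOp A) : A := MulOpposite.unop a

/-- The conjugate linear map with `X ↦ -X` for `X` even and `X ↦ -i X` for `X` odd in the
real form, as a complex linear map to the conjugate opposite algebra. -/
def daggerGen (σ : RealForm L) : L →ₗ[ℂ] ConjOp (U L) where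
  toFun x := ConjOp.mk (-ι L (σ.conj (proj0 L x)) - Complex.I • ι L (σ.conj (proj1 L x)))
  map_add' x y := by
    have e : ∀ a b : U L, ConjOp.mk a + ConjOp.mk b = ConjOp.mk (a + b) := fun a b => rfl
    rw [e]
    congr 1
    simp only [map_add, smul_add]
    abel
  map_smul' c x := by
    have e : ∀ a : U L, c • ConjOp.mk a = ConjOp.mk ((starRingEnd ℂ c) • a) := fun a => rfl
    rw [RingHom.id_apply, e]
    congr 1
    simp only [map_smul, map_smulₛₗ, smul_sub, smul_neg]
    rw [smul_comm]

theorem daggerGen_even (σ : RealForm L) {x : L} (hx : x ∈ (part 0 : Submodule ℂ L)) :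
    daggerGen σ x = ConjOp.mk (-ι L (σ.conj x)) := by
  simp [daggerGen, proj0_even hx, proj1_even hx]

theorem daggerGen_odd (σ : RealForm L) {x : L} (hx : x ∈ (part 1 : Submodule ℂ L)) :
    daggerGen σ x = ConjOp.mk (-(Complex.I • ι L (σ.conj x))) := by
  simp [daggerGen, proj0_odd hx, proj1_odd hx]

theorem daggerGen_rel (σ : RealForm L) {i j : ZMod 2} {x y : L}
    (hx : x ∈ (part i : Submodule ℂ L)) (hy : y ∈ (part j : Submodule ℂ L)) :
    daggerGen σ x * daggerGen σ y - sgn i j • (daggerGen σ y * daggerGen σ x)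
      = daggerGen σ (bracket x y) := by
  have hxy := bracket_mem hx hy
  have h := ι_mul_ι (σ.conj_mem hx) (σ.conj_mem hy)
  rw [← σ.conj_bracket] at h
  have key : ∀ (a b : U L) (c : ℂ), ConjOp.mk a * ConjOp.mk b - c • (ConjOp.mk b * ConjOp.mk a)
      = ConjOp.mk (b * a - (starRingEnd ℂ c) • (a * b)) := fun a b c => rfl
  rcases zmod_two_cases i with rfl | rfl <;> rcases zmod_two_cases j with rfl | rfl
  · simp only [add_zero] at hxy
    rw [daggerGen_even σ hx, daggerGen_even σ hy, daggerGen_even σ hxy, key, ← h]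
    congr 1
    simp [sgn]
  · simp only [zero_add] at hxy
    rw [daggerGen_even σ hx, daggerGen_odd σ hy, daggerGen_odd σ hxy, key, ← h]
    congr 1
    simp [sgn, smul_sub]
  · simp only [add_zero] at hxy
    rw [daggerGen_odd σ hx, daggerGen_even σ hy, daggerGen_odd σ hxy, key, ← h]
    congr 1
    simp [sgn, smul_sub]
  · have e : (1 + 1 : ZMod 2) = 0 := by decide
    rw [e] at hxy
    rw [daggerGen_odd σ hx, daggerGen_odd σ hy, daggerGen_even σ hxy, key, ← h]
    congr 1
    simp [sgn, ZMod.val_one, smul_smul]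
    abel

/-- The conjugate linear (ordinary) antiautomorphism `a ↦ a†` of the enveloping algebra with
`X† = -X` for `X` even and `X† = -i X` for `X` odd in the real form. -/
def dagger (σ : RealForm L) : U L →ₛₗ[starRingEnd ℂ] U L where
  toFun u := ConjOp.out (lift (daggerGen σ) (daggerGen_rel σ) u)
  map_add' u v := by rw [map_add]; rfl
  map_smul' c u := by rw [map_smul]; rfl

theorem dagger_mul (σ : RealForm L) (u v : U L) :
    dagger σ (u * v) = dagger σ v * dagger σ u := by
  change ConjOp.out (lift (daggerGen σ) (daggerGen_rel σ) (u * v)) = _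
  rw [map_mul]; rfl

theorem dagger_algebraMap (σ : RealForm L) (c : ℂ) :
    dagger σ (algebraMap ℂ (U L) c) = algebraMap ℂ (U L) (starRingEnd ℂ c) := by
  change ConjOp.out (lift (daggerGen σ) (daggerGen_rel σ) _) = _
  rw [AlgHom.commutes]; rfl

theorem dagger_ι_even (σ : RealForm L) {x : L} (hx : x ∈ (part 0 : Submodule ℂ L)) :
    dagger σ (ι L x) = -ι L (σ.conj x) := by
  change ConjOp.out (lift (daggerGen σ) (daggerGen_rel σ) _) = _
  rw [lift_ι, daggerGen_even σ hx]; rfl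

theorem dagger_ι_odd (σ : RealForm L) {x : L} (hx : x ∈ (part 1 : Submodule ℂ L)) :
    dagger σ (ι L x) = -(Complex.I • ι L (σ.conj x)) := by
  change ConjOp.out (lift (daggerGen σ) (daggerGen_rel σ) _) = _
  rw [lift_ι, daggerGen_odd σ hx]; rfl

/-- The adjoint `a ↦ a*` of the enveloping algebra: `a* = a†` for `a` even, `a* = i a†` for `a`
odd. The facts below show that it is the conjugate linear map with
`(ab)* = (-1)^(|a||b|) b* a*` and `X* = -(-1)^|X| X` for homogeneous `X` in the real form. -/
def adj (σ : RealForm L) : U L →ₛₗ[starRingEnd ℂ] U L where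
  toFun u := (1 / 2 : ℂ) • (dagger σ u + parity L (dagger σ u))
    + (Complex.I / 2) • (dagger σ u - parity L (dagger σ u))
  map_add' u v := by
    simp only [map_add, smul_add, smul_sub]
    abel
  map_smul' c u := by
    simp only [map_smulₛₗ, smul_add, smul_sub, RingHom.id_apply]
    simp only [smul_comm (starRingEnd ℂ c)]

theorem parity_dagger (σ : RealForm L) (u : U L) :
    parity L (dagger σ u) = dagger σ (parity L u) := by
  induction u using U_induction with
  | hι x =>
    have hx : x = proj0 L x + proj1 L x := by
      obtain ⟨a, b, ha, hb, rfl⟩ := Submodule.codisjoint_iff_exists_add_eq.1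
        (isCompl_part (L := L)).codisjoint x
      simp [proj0_even ha, proj0_odd hb, proj1_even ha, proj1_odd hb]
    have h0 : proj0 L x ∈ (part 0 : Submodule ℂ L) := Submodule.projection_apply_mem _ _
    have h1 : proj1 L x ∈ (part 1 : Submodule ℂ L) := Submodule.projection_apply_mem _ _
    have p0 := ι_mem_homogeneous h0
    have p1 := ι_mem_homogeneous h1
    have q0 := ι_mem_homogeneous (σ.conj_mem h0)
    have q1 := ι_mem_homogeneous (σ.conj_mem h1)
    simp only [homogeneous, Submodule.mem_mk, AddSubmonoid.mem_mk, AddSubsemigroup.mem_mk,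
      Set.mem_ofPred_eq, ZMod.val_zero, ZMod.val_one, pow_zero, pow_one, one_smul,
      neg_smul] at p0 p1 q0 q1
    rw [hx]
    simp only [map_add, p0, p1, map_neg, dagger_ι_even σ h0, dagger_ι_odd σ h1, map_smul, q0, q1,
      smul_neg]
  | hc c => simp [dagger_algebraMap]
  | hmul a b ha hb => simp only [dagger_mul, map_mul, ha, hb]
  | hadd a b ha hb => simp only [map_add, ha, hb]

theorem adj_apply_of_mem (σ : RealForm L) {i : ZMod 2} {a : U L} (ha : a ∈ homogeneous (L := L) i) :
    adj σ a = Complex.I ^ i.val • dagger σ a := by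
  have ha' : parity L a = (-1 : ℂ) ^ i.val • a := ha
  change (1 / 2 : ℂ) • (dagger σ a + parity L (dagger σ a))
    + (Complex.I / 2) • (dagger σ a - parity L (dagger σ a)) = _
  rw [parity_dagger, ha']
  rcases zmod_two_cases i with rfl | rfl
  · simp only [ZMod.val_zero, pow_zero, one_smul, sub_self, smul_zero, add_zero]
    module
  · simp only [ZMod.val_one, pow_one, neg_smul, one_smul, map_neg, add_neg_cancel, smul_zero,
      zero_add, sub_neg_eq_add]
    module

theorem adj_mul (σ : RealForm L) {i j : ZMod 2} {a b : U L} (ha : a ∈ homogeneous (L := L) i)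
    (hb : b ∈ homogeneous (L := L) j) :
    adj σ (a * b) = sgn i j • (adj σ b * adj σ a) := by
  have hab : a * b ∈ homogeneous (L := L) (i + j) := by
    have ha' : parity L a = (-1 : ℂ) ^ i.val • a := ha
    have hb' : parity L b = (-1 : ℂ) ^ j.val • b := hb
    change parity L (a * b) = _
    rw [map_mul, ha', hb', smul_mul_smul_comm]
    congr 1
    rcases zmod_two_cases i with rfl | rfl <;> rcases zmod_two_cases j with rfl | rfl <;>
      simp [ZMod.val_one, show (1 + 1 : ZMod 2) = 0 by decide]
  rw [adj_apply_of_mem σ ha, adj_apply_of_mem σ hb, adj_apply_of_mem σ hab, dagger_mul,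
    smul_mul_smul_comm, smul_smul]
  congr 1
  rcases zmod_two_cases i with rfl | rfl <;> rcases zmod_two_cases j with rfl | rfl <;>
    simp [sgn, ZMod.val_one, show (1 + 1 : ZMod 2) = 0 by decide]

theorem adj_ι (σ : RealForm L) {i : ZMod 2} {x : L} (hx : x ∈ (part i : Submodule ℂ L))
    (hσ : x ∈ σ.carrier) : adj σ (ι L x) = -((-1 : ℂ) ^ i.val • ι L x) := by
  have hσ' : σ.conj x = x := hσ
  rw [adj_apply_of_mem σ (ι_mem_homogeneous hx)]
  rcases zmod_two_cases i with rfl | rfl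
  · simp [dagger_ι_even σ hx, hσ']
  · simp [dagger_ι_odd σ hx, hσ', ZMod.val_one, smul_smul]

/-- A Cartan decomposition `g = k ⊕ p`, `p = p₀ ⊕ g₁`, of a real form: `g₀ = k ⊕ p₀` is a
`ℤ/2`-grading of the Lie algebra `g₀`, and for some inner product on `g` the operators `ad X` are
skew-symmetric for `X ∈ k` and symmetric for `X ∈ p₀`; so `k` is the maximal subalgebra of compact
type, and `g₀` is reductive. The subspace `p₀` is the field `p`. -/
structure CartanDecomposition (σ : RealForm L) where
  k : Submodule ℝ L
  p : Submodule ℝ L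
  sup_eq : k ⊔ p = σ.even
  disjoint : Disjoint k p
  bracket_kk : ∀ x ∈ k, ∀ y ∈ k, bracket x y ∈ k
  bracket_kp : ∀ x ∈ k, ∀ y ∈ p, bracket x y ∈ p
  bracket_pp : ∀ x ∈ p, ∀ y ∈ p, bracket x y ∈ k
  exists_inner : ∃ B : L →ₗ[ℝ] L →ₗ[ℝ] ℝ,
    (∀ x ∈ σ.carrier, ∀ y ∈ σ.carrier, B x y = B y x) ∧
    (∀ x ∈ σ.carrier, x ≠ 0 → 0 < B x x) ∧
    (∀ X ∈ k, ∀ x ∈ σ.carrier, ∀ y ∈ σ.carrier, B (bracket X x) y = -B x (bracket X y)) ∧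
    (∀ X ∈ p, ∀ x ∈ σ.carrier, ∀ y ∈ σ.carrier, B (bracket X x) y = B x (bracket X y))

/-- The complexification of `k`. -/
def CartanDecomposition.kC {σ : RealForm L} (D : CartanDecomposition σ) : Submodule ℂ L :=
  Submodule.span ℂ (D.k : Set L)

/-- The complexification of `p₀`. -/
def CartanDecomposition.pC {σ : RealForm L} (D : CartanDecomposition σ) : Submodule ℂ L :=
  Submodule.span ℂ (D.p : Set L)

end Real

/-! ### Roots and contragredient Lie superalgebras -/

section Roots

variable {L : Type*} [AddCommGroup L] [Module ℂ L] [LieSuperalgebra L]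

/-- The simultaneous eigenspace of `ad h` on `L` with eigenvalue `α`. -/
def rootSpace (h : Submodule ℂ L) (α : Module.Dual ℂ h) : Submodule ℂ L where
  carrier := {x | ∀ H : h, bracket (H : L) x = α H • x}
  add_mem' := by
    intro a b ha hb H
    rw [map_add, ha H, hb H, smul_add]
  zero_mem' := by simp
  smul_mem' := by
    intro c a ha H
    rw [map_smul, ha H, smul_comm]

/-- `h` is a Cartan subalgebra of `L`: an even subspace that acts diagonalizably on `L` by `ad`
and is equal to its own centralizer (so it is abelian). -/
structure IsCartanSubalgebra (h : Submodule ℂ L) : Prop where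
  le_even : h ≤ part 0
  rootSpace_zero : rootSpace h 0 = h
  iSup_rootSpace : ⨆ α : Module.Dual ℂ h, rootSpace h α = ⊤

theorem IsCartanSubalgebra.bracket_eq_zero {h : Submodule ℂ L} (hh : IsCartanSubalgebra h)
    {x y : L} (hx : x ∈ h) (hy : y ∈ h) : bracket x y = 0 := by
  have h0 : y ∈ rootSpace h 0 := by rw [hh.rootSpace_zero]; exact hy
  simpa using h0 ⟨x, hx⟩

/-- The roots of `L` with respect to `h`. -/
def roots (h : Submodule ℂ L) : Set (Module.Dual ℂ h) := {α | α ≠ 0 ∧ rootSpace h α ≠ ⊥}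

/-- A subspace of a Lie superalgebra is graded if it is the sum of its even and odd parts. -/
def IsGraded (I : Submodule ℂ L) : Prop := I = (I ⊓ part 0) ⊔ (I ⊓ part 1)

/-- Chevalley generators of a contragredient Lie superalgebra with respect to `h`: with the
Cartan matrix `a i j = simpleRoot j (coroot i)` and the set of odd indices `{i | deg i = 1}`, the
superalgebra is generated by `h` and the `e i`, `f i`, these satisfy the contragredient relations,
and no nonzero graded ideal meets `h` trivially. -/
structure ContragredientGenerators (h : Submodule ℂ L) (n : ℕ) where
  deg : Fin n → ZMod 2
  e : Fin n → L
  f : Fin n → L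
  coroot : Fin n → h
  simpleRoot : Fin n → Module.Dual ℂ h
  e_mem : ∀ i, e i ∈ (part (deg i) : Submodule ℂ L)
  f_mem : ∀ i, f i ∈ (part (deg i) : Submodule ℂ L)
  linearIndependent_coroot : LinearIndependent ℂ coroot
  bracket_e_f : ∀ i j, bracket (e i) (f j) = if i = j then (coroot i : L) else 0
  bracket_h_e : ∀ (H : h) i, bracket (H : L) (e i) = simpleRoot i H • e i
  bracket_h_f : ∀ (H : h) i, bracket (H : L) (f i) = -(simpleRoot i H • f i)
  generates : ∀ S : Submodule ℂ L, (∀ x ∈ S, ∀ y ∈ S, bracket x y ∈ S) → h ≤ S →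
    (∀ i, e i ∈ S) → (∀ i, f i ∈ S) → S = ⊤
  ideal_eq_bot : ∀ I : Submodule ℂ L, IsGraded I → (∀ x, ∀ y ∈ I, bracket x y ∈ I) →
    I ⊓ h = ⊥ → I = ⊥

/-- `L` is contragredient with Cartan subalgebra `h`. -/
def IsContragredient (h : Submodule ℂ L) : Prop := ∃ n, Nonempty (ContragredientGenerators h n)

/-- A positive system: the roots on which a regular real linear functional is positive. -/
def IsPositiveSystem (h : Submodule ℂ L) (P : Set (Module.Dual ℂ h)) : Prop :=
  ∃ φ : Module.Dual ℂ h →ₗ[ℝ] ℝ, (∀ α ∈ roots h, φ α ≠ 0) ∧ P = {α ∈ roots h | 0 < φ α}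

/-- `H` is the coroot `H_α`: it lies in `[g_α, g_{-α}]` and `α(H) = 2`. -/
def IsCoroot (h : Submodule ℂ L) (α : Module.Dual ℂ h) (H : h) : Prop :=
  α H = 2 ∧ (H : L) ∈ Submodule.span ℂ
    {z | ∃ x ∈ rootSpace h α, ∃ y ∈ rootSpace h (-α), z = bracket x y}

end Roots

/-! ### The Harish-Chandra map -/

section HarishChandra

variable {L : Type*} [AddCommGroup L] [Module ℂ L] [LieSuperalgebra L]

theorem IsCartanSubalgebra.ι_comm {h : Submodule ℂ L} (hh : IsCartanSubalgebra h) :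
    ∀ a ∈ (ι L '' (h : Set L)), ∀ b ∈ (ι L '' (h : Set L)), a * b = b * a := by
  rintro _ ⟨x, hx, rfl⟩ _ ⟨y, hy, rfl⟩
  have e := ι_mul_ι (hh.le_even hx) (hh.le_even hy)
  rw [hh.bracket_eq_zero hx hy, map_zero, sub_eq_zero] at e
  simpa [sgn] using e

/-- The image of `S(h) = U(h)` in `U(L)`: the subalgebra generated by `h`. -/
abbrev cartanU (h : Submodule ℂ L) : Subalgebra ℂ (U L) := Algebra.adjoin ℂ (ι L '' (h : Set L))

/-- The commutative ring structure on the subalgebra generated by `h`. -/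
abbrev cartanURing {h : Submodule ℂ L} (hh : IsCartanSubalgebra h) : CommRing (cartanU h) :=
  { (inferInstance : Ring (cartanU h)) with
    mul_comm := (Algebra.isMulCommutative_adjoin ℂ hh.ι_comm).is_comm.comm }

/-- The inclusion `S(h) = U(h) → U(L)`: the homomorphism that is the canonical map on `h`. -/
def symToU {h : Submodule ℂ L} (hh : IsCartanSubalgebra h) : SymmetricAlgebra ℂ h →ₐ[ℂ] U L :=
  letI : CommRing (cartanU h) := cartanURing hh
  (cartanU h).val.comp
    (SymmetricAlgebra.lift (R := ℂ) (M := h) (A := cartanU h)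
      (((ι L) ∘ₗ h.subtype).codRestrict (Subalgebra.toSubmodule (cartanU h))
        (fun x => Algebra.subset_adjoin ⟨x, x.2, rfl⟩)))

theorem symToU_ι {h : Submodule ℂ L} (hh : IsCartanSubalgebra h) (x : h) :
    symToU hh (SymmetricAlgebra.ι ℂ h x) = ι L x := by
  letI : CommRing (cartanU h) := cartanURing hh
  change ((SymmetricAlgebra.lift (R := ℂ) (M := h) (A := cartanU h) _
    (SymmetricAlgebra.ι ℂ h x) : cartanU h) : U L) = _
  rw [SymmetricAlgebra.lift_ι_apply]
  rfl

/-- The value at `lam ∈ h*` of an element of `S(h)`, seen as a polynomial function on `h*`. -/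
def evalAt {h : Submodule ℂ L} (lam : Module.Dual ℂ h) : SymmetricAlgebra ℂ h →ₐ[ℂ] ℂ :=
  SymmetricAlgebra.lift lam

/-- The weight space `U[μ] = {a | [H, a] = μ(H) a for all H ∈ h}` of the enveloping algebra. -/
def weightU (h : Submodule ℂ L) (μ : Module.Dual ℂ h) : Submodule ℂ (U L) where
  carrier := {a | ∀ H : h, ι L H * a - a * ι L H = μ H • a}
  add_mem' := by
    intro a b ha hb H
    rw [smul_add, ← ha H, ← hb H, mul_add, add_mul]
    abel
  zero_mem' := by simp
  smul_mem' := by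
    intro c a ha H
    rw [smul_comm, ← ha H, smul_sub, mul_smul_comm, smul_mul_assoc]

/-- The left ideal `∑_{γ ∈ P} U(L) g_γ`. -/
def posIdeal (h : Submodule ℂ L) (P : Set (Module.Dual ℂ h)) : Submodule (U L) (U L) :=
  Submodule.span (U L) {u | ∃ γ ∈ P, ∃ x ∈ rootSpace h γ, u = ι L x}

/-- `p = β(u)`: the component `u₀` of `u` in `U[0]`, along the sum of the `U[μ]` with `μ ≠ 0`,
is congruent to `p ∈ U(h)` modulo `∑_{γ ∈ P} U(L) g_γ`. -/
def IsHarishChandra {h : Submodule ℂ L} (hh : IsCartanSubalgebra h) (P : Set (Module.Dual ℂ h))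
    (u : U L) (p : SymmetricAlgebra ℂ h) : Prop :=
  ∃ u₀ ∈ weightU h 0, ∃ u₁ ∈ ⨆ μ : {μ : Module.Dual ℂ h // μ ≠ 0}, weightU h μ,
    u = u₀ + u₁ ∧ u₀ - symToU hh p ∈ posIdeal h P

/-- The Harish-Chandra map `β : U(L) → U(h) = S(h)`: `β(u)` is the unique `p` with
`IsHarishChandra hh P u p`. -/
def harishChandra {h : Submodule ℂ L} (hh : IsCartanSubalgebra h) (P : Set (Module.Dual ℂ h))
    (u : U L) : SymmetricAlgebra ℂ h :=
  Classical.epsilon (IsHarishChandra hh P u)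

end HarishChandra

/-! ### Representations -/

section Representations

variable (L : Type*) [AddCommGroup L] [Module ℂ L] [LieSuperalgebra L]
variable (V : Type*) [AddCommGroup V] [Module ℂ V]

/-- A representation of a Lie superalgebra on a complex super vector space `V = V₀ ⊕ V₁`. -/
structure SuperRep where
  vpart : ZMod 2 → Submodule ℂ V
  isCompl_vpart : IsCompl (vpart 0) (vpart 1)
  toLin : L →ₗ[ℂ] Module.End ℂ V
  toLin_mem : ∀ {i j : ZMod 2} {x : L} {v : V}, x ∈ (part i : Submodule ℂ L) → v ∈ vpart j →
    toLin x v ∈ vpart (i + j)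
  toLin_bracket : ∀ {i j : ZMod 2} {x y : L}, x ∈ (part i : Submodule ℂ L) →
    y ∈ (part j : Submodule ℂ L) →
    toLin x * toLin y - sgn i j • (toLin y * toLin x) = toLin (bracket x y)

variable {L V}

/-- The action of the enveloping algebra on a representation. -/
def SuperRep.act (π : SuperRep L V) : U L →ₐ[ℂ] Module.End ℂ V := lift π.toLin π.toLin_bracket

/-- Irreducibility: `V ≠ 0`, and the only graded invariant subspaces are `0` and `V`. -/
def SuperRep.IsIrreducible (π : SuperRep L V) : Prop :=
  Nontrivial V ∧ ∀ W : Submodule ℂ V, W = (W ⊓ π.vpart 0) ⊔ (W ⊓ π.vpart 1) →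
    (∀ x, ∀ w ∈ W, π.toLin x w ∈ W) → W = ⊥ ∨ W = ⊤

/-- `v` is a highest weight vector of weight `lam` generating `V`. -/
structure SuperRep.IsHighestWeightVector (π : SuperRep L V) (h : Submodule ℂ L)
    (P : Set (Module.Dual ℂ h)) (lam : Module.Dual ℂ h) (v : V) : Prop where
  ne_zero : v ≠ 0
  homogeneous : ∃ i, v ∈ π.vpart i
  weight : ∀ H : h, π.toLin H v = lam H • v
  annihilated : ∀ γ ∈ P, ∀ x ∈ rootSpace h γ, π.toLin x v = 0
  generates : ∀ w, ∃ u, π.act u v = w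

/-- Unitarity with respect to a real form: there is a super hermitian product `( , )`, linear in
the first and antilinear in the second argument, with `( , )` positive definite on `V₀`,
`i ( , )` positive definite on `V₁`, for which `π(X)* = -(-1)^|X| π(X)` for all homogeneous `X` in
the real form, where `(Tu, w) = (-1)^(|u||T|) (u, T* w)`. -/
def SuperRep.IsUnitary (π : SuperRep L V) (σ : RealForm L) : Prop :=
  ∃ B : V →ₗ[ℂ] V →ₛₗ[starRingEnd ℂ] ℂ,
    (∀ i j, ∀ u ∈ π.vpart i, ∀ w ∈ π.vpart j, B u w = sgn i j * starRingEnd ℂ (B w u)) ∧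
    (∀ i j, i ≠ j → ∀ u ∈ π.vpart i, ∀ w ∈ π.vpart j, B u w = 0) ∧
    (∀ u ∈ π.vpart 0, u ≠ 0 → 0 < B u u) ∧
    (∀ u ∈ π.vpart 1, u ≠ 0 → 0 < Complex.I * B u u) ∧
    (∀ i j, ∀ X ∈ σ.carrier, X ∈ (part i : Submodule ℂ L) → ∀ u ∈ π.vpart j, ∀ w,
      B (π.toLin X u) w = sgn j i * B u (-((-1 : ℂ) ^ i.val • π.toLin X w)))

end Representations

end

end SuperHC

open SuperHC

/-!
Put `a†` for the ordinary (unsigned) conjugate linear antiautomorphism `dagger` of the enveloping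
algebra. For homogeneous `a` one has `a* = i^|a| a†`, so `(-i)^|a| β(a* a)(λ) = β(a† a)(λ)`. In the
same way, multiplying a super Hermitian form by `i` on `V₁` turns it into an ordinary Hermitian
form, and `π` is unitary if and only if `V` has an ordinary positive definite Hermitian form, with
`V₀ ⊥ V₁`, for which the adjoint of `a` is `a†` (`SuperRep.isUnitary_iff`).

The link with the Harish-Chandra map is that `β(u)(λ)` is the coefficient of the highest weight
vector `v` in `u v`, along the sum of the other weight spaces
(`SuperRep.IsHighestWeightVector.evalAt_harishChandra`). This determines `β(u)(λ)` without the
linear independence half of the Poincaré–Birkhoff–Witt theorem; the spanning half is needed for the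
existence of `β(u)` (`exists_isHarishChandra`), and follows by moving elements of `L` to the right
through words in `h ⊕ n⁻`, together with the weight grading of `∑ U(L) g_γ`.

If `π` is unitary, then the weight vectors of weight other than `λ` are orthogonal to `v`, so
`β(a† a)(λ) = (a v, a v) / (v, v)`. Conversely, if `β(a† a)(λ) ≥ 0` for all homogeneous `a`, then
`(a v, b v) = β(b† a)(λ)` is Hermitian by polarization, hence well defined on `V`; it is
nonnegative, and its radical is a proper graded invariant subspace, which is `0` by irreducibility.

For the sign of `λ(H_α)`, let `e` be a root vector of `α ∈ P`, and `σ` the conjugation of the real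
form. As `h` lies in the complexification of `k`, the roots are imaginary on `h ∩ k` and
`σ(e) ∈ g_{-α}`; then `(σ(e) v, σ(e) v) = -λ([e, σ(e)]) (v, v)` (up to conjugation), so
`λ([e, σ(e)]) ≤ 0`. The Hermitian extension of the inner product of the Cartan decomposition shows
that `[g_α, g_{-α}]` is spanned by `[e, σ(e)]`, and that `α([e, σ(e)])` is negative for `α` compact
and positive for `α` noncompact (`exists_smul_bracket_conj_eq_coroot`).
-/

open scoped ComplexOrder

namespace SuperHC

noncomputable section

open LieSuperalgebra

/-! ### The parity grading of the enveloping algebra -/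

section Grading

variable {L : Type*} [AddCommGroup L] [Module ℂ L] [LieSuperalgebra L]

theorem proj0_mem (x : L) : proj0 L x ∈ (part 0 : Submodule ℂ L) :=
  Submodule.projection_apply_mem _ _

theorem proj1_mem (x : L) : proj1 L x ∈ (part 1 : Submodule ℂ L) :=
  Submodule.projection_apply_mem _ _

theorem proj0_add_proj1 (x : L) : proj0 L x + proj1 L x = x := by
  obtain ⟨a, b, ha, hb, rfl⟩ := Submodule.codisjoint_iff_exists_add_eq.1
    (isCompl_part (L := L)).codisjoint x
  simp [proj0_even ha, proj0_odd hb, proj1_even ha, proj1_odd hb]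

theorem mem_homogeneous {i : ZMod 2} {u : U L} :
    u ∈ homogeneous (L := L) i ↔ parity L u = (-1 : ℂ) ^ i.val • u := Iff.rfl

theorem neg_one_pow_val_add (i j : ZMod 2) :
    (-1 : ℂ) ^ (i + j).val = (-1) ^ i.val * (-1) ^ j.val := by
  rcases zmod_two_cases i with rfl | rfl <;> rcases zmod_two_cases j with rfl | rfl <;>
    simp [ZMod.val_one, show (1 + 1 : ZMod 2) = 0 by decide]

theorem parity_parity (u : U L) : parity L (parity L u) = u := by
  induction u using U_induction with
  | hι x =>
    rw [parity_ι, parity_ι]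
    simp only [map_sub, proj0_even (proj0_mem x), proj0_odd (proj1_mem x),
      proj1_even (proj0_mem x), proj1_odd (proj1_mem x), sub_zero, zero_sub,
      sub_neg_eq_add, proj0_add_proj1]
  | hc c => simp
  | hmul a b ha hb => simp only [map_mul, ha, hb]
  | hadd a b ha hb => simp only [map_add, ha, hb]

/-- The enveloping algebra is the sum of its even and odd parts. -/
theorem exists_homogeneous_add (u : U L) :
    ∃ a : ZMod 2 → U L, (∀ i, a i ∈ homogeneous (L := L) i) ∧ u = a 0 + a 1 := by
  refine ⟨fun i => (1 / 2 : ℂ) • (u + (-1 : ℂ) ^ i.val • parity L u), fun i => ?_, ?_⟩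
  · rw [mem_homogeneous]
    simp only [map_smul, map_add, parity_parity]
    rcases zmod_two_cases i with rfl | rfl
    · simp [add_comm]
    · simp only [ZMod.val_one, pow_one]
      module
  · simp only [ZMod.val_zero, ZMod.val_one, pow_zero, pow_one]
    module

end Grading

/-! ### Weights in the enveloping algebra -/

section Weights

variable {L : Type*} [AddCommGroup L] [Module ℂ L] [LieSuperalgebra L] {h : Submodule ℂ L}

theorem mem_rootSpace {α : Module.Dual ℂ h} {x : L} :
    x ∈ rootSpace h α ↔ ∀ H : h, bracket (H : L) x = α H • x := Iff.rfl

theorem mem_weightU {μ : Module.Dual ℂ h} {a : U L} :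
    a ∈ weightU h μ ↔ ∀ H : h, ι L H * a - a * ι L H = μ H • a := Iff.rfl

/-- Root spaces are graded, since `h` is even. -/
theorem proj_mem_rootSpace (hh : IsCartanSubalgebra h) {α : Module.Dual ℂ h} {x : L}
    (hx : x ∈ rootSpace h α) : proj0 L x ∈ rootSpace h α ∧ proj1 L x ∈ rootSpace h α := by
  have key : ∀ H : h, bracket (H : L) (proj0 L x) = α H • proj0 L x ∧
      bracket (H : L) (proj1 L x) = α H • proj1 L x := by
    intro H
    have b0 := bracket_mem (hh.le_even H.2) (proj0_mem x)
    have b1 := bracket_mem (hh.le_even H.2) (proj1_mem x)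
    rw [zero_add] at b0 b1
    have e := mem_rootSpace.1 hx H
    rw [← proj0_add_proj1 x, map_add] at e
    have e0 := congrArg (proj0 L) e
    have e1 := congrArg (proj1 L) e
    simp only [map_add, map_smul, proj0_even b0, proj0_odd b1, proj1_even b0, proj1_odd b1,
      proj0_even (proj0_mem x), proj0_odd (proj1_mem x), proj1_even (proj0_mem x),
      proj1_odd (proj1_mem x), add_zero, zero_add] at e0 e1
    exact ⟨e0, e1⟩
  exact ⟨fun H => (key H).1, fun H => (key H).2⟩

theorem exists_part_add_rootSpace (hh : IsCartanSubalgebra h) {α : Module.Dual ℂ h} {x : L}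
    (hx : x ∈ rootSpace h α) : ∃ y z, y ∈ rootSpace h α ∧ z ∈ rootSpace h α ∧
      y ∈ (part 0 : Submodule ℂ L) ∧ z ∈ (part 1 : Submodule ℂ L) ∧ x = y + z :=
  ⟨_, _, (proj_mem_rootSpace hh hx).1, (proj_mem_rootSpace hh hx).2, proj0_mem x, proj1_mem x,
    (proj0_add_proj1 x).symm⟩

/-- An element of `h` is even, so its supercommutator in the enveloping algebra is an ordinary
commutator. -/
theorem ι_mul_sub_mul_ι (hh : IsCartanSubalgebra h) (H : h) (x : L) :
    ι L H * ι L x - ι L x * ι L H = ι L (bracket (H : L) x) := by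
  have e0 := ι_mul_ι (hh.le_even H.2) (proj0_mem x)
  have e1 := ι_mul_ι (hh.le_even H.2) (proj1_mem x)
  simp only [sgn, ZMod.val_zero, zero_mul, pow_zero, one_smul] at e0 e1
  rw [← proj0_add_proj1 x, map_add, map_add, map_add, ← e0, ← e1, mul_add, add_mul]
  abel

theorem ι_mem_weightU (hh : IsCartanSubalgebra h) {α : Module.Dual ℂ h} {x : L}
    (hx : x ∈ rootSpace h α) : ι L x ∈ weightU h α := by
  intro H
  rw [ι_mul_sub_mul_ι hh, mem_rootSpace.1 hx H, map_smul]

theorem mul_mem_weightU {μ ν : Module.Dual ℂ h} {a b : U L} (ha : a ∈ weightU h μ)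
    (hb : b ∈ weightU h ν) : a * b ∈ weightU h (μ + ν) := by
  intro H
  have e1 := mem_weightU.1 ha H
  have e2 := mem_weightU.1 hb H
  rw [LinearMap.add_apply, add_smul, ← smul_mul_assoc, ← mul_smul_comm, ← e1, ← e2]
  noncomm_ring

theorem algebraMap_mem_weightU (c : ℂ) : algebraMap ℂ (U L) c ∈ weightU h 0 := by
  intro H
  rw [Algebra.commutes, sub_self, LinearMap.zero_apply, zero_smul]

theorem ι_cartan_mem_weightU (hh : IsCartanSubalgebra h) (H : h) : ι L (H : L) ∈ weightU h 0 := by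
  refine ι_mem_weightU hh ?_
  rw [hh.rootSpace_zero]
  exact H.2

theorem symToU_mem_weightU (hh : IsCartanSubalgebra h) (p : SymmetricAlgebra ℂ h) :
    symToU hh p ∈ weightU h 0 := by
  induction p using SymmetricAlgebra.induction with
  | algebraMap r => rw [AlgHom.commutes]; exact algebraMap_mem_weightU r
  | ι x => rw [symToU_ι]; exact ι_cartan_mem_weightU hh x
  | mul a b ha hb => rw [map_mul]; simpa using mul_mem_weightU ha hb
  | add a b ha hb => rw [map_add]; exact add_mem ha hb

theorem iSup_weightU (hh : IsCartanSubalgebra h) (u : U L) : u ∈ ⨆ μ, weightU h μ := by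
  induction u using U_induction with
  | hι x =>
    have hx : x ∈ ⨆ α : Module.Dual ℂ h, rootSpace h α := by
      rw [hh.iSup_rootSpace]; trivial
    induction hx using Submodule.iSup_induction' with
    | mem α x hx => exact Submodule.mem_iSup_of_mem α (ι_mem_weightU hh hx)
    | zero => simp
    | add x y _ _ hx hy => rw [map_add]; exact add_mem hx hy
  | hc c => exact Submodule.mem_iSup_of_mem 0 (algebraMap_mem_weightU c)
  | hadd a b ha hb => exact add_mem ha hb
  | hmul a b ha hb =>
    induction ha using Submodule.iSup_induction' with
    | mem α a ha =>
      induction hb using Submodule.iSup_induction' with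
      | mem β b hb => exact Submodule.mem_iSup_of_mem (α + β) (mul_mem_weightU ha hb)
      | zero => simp
      | add x y _ _ hx hy => rw [mul_add]; exact add_mem hx hy
    | zero => simp
    | add x y _ _ hx hy => rw [add_mul]; exact add_mem hx hy

/-- The left ideal `∑_{γ ∈ P} U(L) g_γ` is graded by weights: each of its elements is, up to
elements of nonzero weight, an element of the ideal of weight `0`. -/
theorem exists_weight_zero_of_mem_posIdeal (hh : IsCartanSubalgebra h)
    {P : Set (Module.Dual ℂ h)} {k : U L} (hk : k ∈ posIdeal h P) :
    ∃ k₀ ∈ weightU h 0, k₀ ∈ posIdeal h P ∧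
      k - k₀ ∈ ⨆ μ : {μ : Module.Dual ℂ h // μ ≠ 0}, weightU h μ := by
  have step : ∀ u : U L, ∀ γ ∈ P, ∀ x ∈ rootSpace h γ, ∃ k₀ ∈ weightU h 0, k₀ ∈ posIdeal h P ∧
      u * ι L x - k₀ ∈ ⨆ μ : {μ : Module.Dual ℂ h // μ ≠ 0}, weightU h μ := by
    intro u γ hγ x hx
    have hxP : ι L x ∈ posIdeal h P := Submodule.subset_span ⟨γ, hγ, x, hx, rfl⟩
    induction iSup_weightU hh u using Submodule.iSup_induction' with
    | mem μ u hu =>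
      have hux := mul_mem_weightU hu (ι_mem_weightU hh hx)
      by_cases h0 : μ + γ = 0
      · refine ⟨u * ι L x, h0 ▸ hux, Submodule.smul_mem _ u hxP, by simp⟩
      · refine ⟨0, zero_mem _, zero_mem _, ?_⟩
        rw [sub_zero]
        exact Submodule.mem_iSup_of_mem (⟨μ + γ, h0⟩ : {μ : Module.Dual ℂ h // μ ≠ 0}) hux
    | zero => exact ⟨0, zero_mem _, zero_mem _, by simp⟩
    | add a b _ _ ha hb =>
      obtain ⟨k, h1, h2, h3⟩ := ha
      obtain ⟨l, h4, h5, h6⟩ := hb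
      refine ⟨k + l, add_mem h1 h4, add_mem h2 h5, ?_⟩
      have := add_mem h3 h6
      rwa [sub_add_sub_comm, ← add_mul] at this
  induction hk using Submodule.span_induction with
  | mem x hx =>
    obtain ⟨γ, hγ, y, hy, rfl⟩ := hx
    simpa using step 1 γ hγ y hy
  | zero => exact ⟨0, zero_mem _, zero_mem _, by simp⟩
  | add a b _ _ ha hb =>
    obtain ⟨k, h1, h2, h3⟩ := ha
    obtain ⟨l, h4, h5, h6⟩ := hb
    refine ⟨k + l, add_mem h1 h4, add_mem h2 h5, ?_⟩
    have := add_mem h3 h6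
    rwa [sub_add_sub_comm] at this
  | smul u y hy ih =>
    clear ih
    induction hy using Submodule.span_induction generalizing u with
    | mem x hx =>
      obtain ⟨γ, hγ, y, hy, rfl⟩ := hx
      exact step u γ hγ y hy
    | zero => exact ⟨0, zero_mem _, zero_mem _, by simp⟩
    | add a b _ _ ha hb =>
      obtain ⟨k, h1, h2, h3⟩ := ha u
      obtain ⟨l, h4, h5, h6⟩ := hb u
      refine ⟨k + l, add_mem h1 h4, add_mem h2 h5, ?_⟩
      have := add_mem h3 h6
      rwa [sub_add_sub_comm, ← smul_add] at this
    | smul w y _ ih =>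
      rw [smul_smul]
      exact ih _

end Weights

/-! ### Existence of the Harish-Chandra projection -/

section HarishChandraExistence

variable {L : Type*} [AddCommGroup L] [Module ℂ L] [LieSuperalgebra L] {h : Submodule ℂ L}

/-- The homogeneous elements of `h` and the homogeneous root vectors on whose roots `φ` is
negative, in the enveloping algebra: generators of `U(h ⊕ n⁻)`. -/
def lowerGens (h : Submodule ℂ L) (φ : Module.Dual ℂ h →ₗ[ℝ] ℝ) : Set (U L) :=
  {u | ∃ x : L, (x ∈ h ∨ ∃ γ, φ γ < 0 ∧ x ∈ rootSpace h γ) ∧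
    (∃ i, x ∈ (part i : Submodule ℂ L)) ∧ u = ι L x}

/-- The triangular decomposition `L = (n⁻ ⊕ h) + n⁺`. -/
theorem ι_mem_lowerGens_sup_posIdeal (hh : IsCartanSubalgebra h)
    {P : Set (Module.Dual ℂ h)} {φ : Module.Dual ℂ h →ₗ[ℝ] ℝ} (hφ : ∀ α ∈ roots h, φ α ≠ 0)
    (hP : P = {α ∈ roots h | 0 < φ α}) (x : L) :
    ι L x ∈ Submodule.span ℂ (lowerGens h φ) ⊔ (posIdeal h P).restrictScalars ℂ := by
  have hx : x ∈ ⨆ α : Module.Dual ℂ h, rootSpace h α := by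
    rw [hh.iSup_rootSpace]; trivial
  induction hx using Submodule.iSup_induction' with
  | zero => simp
  | add x y _ _ hx hy => rw [map_add]; exact add_mem hx hy
  | mem α x hx =>
    by_cases h0 : α = 0
    · subst h0
      rw [hh.rootSpace_zero] at hx
      exact Submodule.mem_sup_left (Submodule.subset_span ⟨x, Or.inl hx, ⟨0, hh.le_even hx⟩, rfl⟩)
    by_cases hx0 : x = 0
    · simp [hx0]
    have hα : α ∈ roots h := ⟨h0, fun hb => hx0 (by simpa [hb] using hx)⟩
    rcases lt_or_gt_of_ne (hφ α hα) with hneg | hpos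
    · obtain ⟨y, z, hy, hz, hy0, hz1, rfl⟩ := exists_part_add_rootSpace hh hx
      rw [map_add]
      exact Submodule.mem_sup_left (add_mem
        (Submodule.subset_span ⟨y, Or.inr ⟨α, hneg, hy⟩, ⟨0, hy0⟩, rfl⟩)
        (Submodule.subset_span ⟨z, Or.inr ⟨α, hneg, hz⟩, ⟨1, hz1⟩, rfl⟩))
    · exact Submodule.mem_sup_right (Submodule.subset_span ⟨α, hP ▸ ⟨hα, hpos⟩, x, hx, rfl⟩)

/-- The spanning half of the Poincaré–Birkhoff–Witt theorem for `L = (n⁻ ⊕ h) ⊕ n⁺`. -/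
theorem mem_closure_lowerGens_sup_posIdeal (hh : IsCartanSubalgebra h)
    {P : Set (Module.Dual ℂ h)} {φ : Module.Dual ℂ h →ₗ[ℝ] ℝ} (hφ : ∀ α ∈ roots h, φ α ≠ 0)
    (hP : P = {α ∈ roots h | 0 < φ α}) (u : U L) :
    u ∈ Submodule.span ℂ (Submonoid.closure (lowerGens h φ) : Set (U L)) ⊔
      (posIdeal h P).restrictScalars ℂ := by
  set A := Submodule.span ℂ (Submonoid.closure (lowerGens h φ) : Set (U L)) with hA
  set K := (posIdeal h P).restrictScalars ℂ with hK
  have hgen : ∀ x : L, ι L x ∈ A ⊔ K := fun x =>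
    (sup_le_sup_right (Submodule.span_mono Submonoid.subset_closure) K :
      Submodule.span ℂ (lowerGens h φ) ⊔ K ≤ A ⊔ K) (ι_mem_lowerGens_sup_posIdeal hh hφ hP x)
  have hgmul : ∀ g ∈ lowerGens h φ, ∀ w ∈ A ⊔ K, g * w ∈ A ⊔ K := by
    intro g hg w hw
    obtain ⟨a, ha, k, hk, rfl⟩ := Submodule.mem_sup.1 hw
    rw [mul_add]
    refine Submodule.add_mem_sup ?_ (Submodule.smul_mem (posIdeal h P) g hk)
    induction ha using Submodule.span_induction with
    | mem x hx => exact Submodule.subset_span (mul_mem (Submonoid.subset_closure hg) hx)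
    | zero => simp
    | add x y _ _ hx hy =>
      rw [mul_add]
      exact add_mem (hx (Submodule.add_mem_sup (by assumption) hk))
        (hy (Submodule.add_mem_sup (by assumption) hk))
    | smul c x _ hx =>
      rw [mul_smul_comm]
      exact Submodule.smul_mem _ _ (hx (Submodule.add_mem_sup (by assumption) hk))
  -- Move an arbitrary element of `L` to the right through a word in the lower generators.
  have hword : ∀ w ∈ Submonoid.closure (lowerGens h φ), ∀ z : L, ι L z * w ∈ A ⊔ K := by
    intro w hw
    induction hw using Submonoid.closure_induction_left with
    | one => intro z; rw [mul_one]; exact hgen z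
    | mul_left g hg w hw ih =>
      have hom : ∀ i, ∀ z ∈ (part i : Submodule ℂ L), ι L z * (g * w) ∈ A ⊔ K := by
        intro i z hz
        have hg' := hg
        obtain ⟨y, -, ⟨j, hy⟩, rfl⟩ := hg'
        have e := ι_mul_ι hz hy
        rw [sub_eq_iff_eq_add] at e
        rw [← mul_assoc, e, add_mul, smul_mul_assoc, mul_assoc]
        exact add_mem (ih _) (Submodule.smul_mem _ _ (hgmul _ hg _ (ih z)))
      intro z
      rw [← proj0_add_proj1 z, map_add, add_mul]
      exact add_mem (hom 0 _ (proj0_mem z)) (hom 1 _ (proj1_mem z))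
  have hmul : ∀ z : L, ∀ w ∈ A ⊔ K, ι L z * w ∈ A ⊔ K := by
    intro z w hw
    obtain ⟨a, ha, k, hk, rfl⟩ := Submodule.mem_sup.1 hw
    rw [mul_add]
    refine add_mem ?_ (Submodule.mem_sup_right (Submodule.smul_mem (posIdeal h P) _ hk))
    clear hw
    induction ha using Submodule.span_induction with
    | mem x hx => exact hword x hx z
    | zero => simp
    | add x y _ _ hx hy => rw [mul_add]; exact add_mem hx hy
    | smul c x _ hx => rw [mul_smul_comm]; exact Submodule.smul_mem _ _ hx
  have key : ∀ u : U L, ∀ w ∈ A ⊔ K, u * w ∈ A ⊔ K := by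
    intro u
    induction u using U_induction with
    | hι x => exact hmul x
    | hc c =>
      intro w hw
      rw [← Algebra.smul_def]
      exact Submodule.smul_mem _ _ hw
    | hmul a b ha hb => intro w hw; rw [mul_assoc]; exact ha _ (hb _ hw)
    | hadd a b ha hb => intro w hw; rw [add_mul]; exact add_mem (ha _ hw) (hb _ hw)
  simpa using key u 1 (Submodule.mem_sup_left (Submodule.subset_span (one_mem _)))

/-- `U(h ⊕ n⁻)` is the sum of `U(h)` and of elements of negative weight. -/
theorem span_closure_lowerGens_le (hh : IsCartanSubalgebra h) (φ : Module.Dual ℂ h →ₗ[ℝ] ℝ) :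
    Submodule.span ℂ (Submonoid.closure (lowerGens h φ) : Set (U L)) ≤
      LinearMap.range (symToU hh).toLinearMap ⊔
        ⨆ μ : {μ : Module.Dual ℂ h // φ μ < 0}, weightU h μ := by
  set T := LinearMap.range (symToU hh).toLinearMap with hT
  set W := ⨆ μ : {μ : Module.Dual ℂ h // φ μ < 0}, weightU h μ with hW
  have hW' : ∀ μ, φ μ < 0 → weightU h μ ≤ W := fun μ hμ =>
    le_iSup (fun μ : {μ : Module.Dual ℂ h // φ μ < 0} => weightU h (μ : Module.Dual ℂ h)) ⟨μ, hμ⟩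
  have mulW : ∀ ν, φ ν ≤ 0 → ∀ g ∈ weightU h ν, ∀ w ∈ W, g * w ∈ W := by
    intro ν hν g hg w hw
    induction hw using Submodule.iSup_induction' with
    | mem μ w hw =>
      refine hW' (ν + μ) ?_ (mul_mem_weightU hg hw)
      rw [map_add]
      linarith [μ.2]
    | zero => simp
    | add x y _ _ hx hy => rw [mul_add]; exact add_mem hx hy
  rw [Submodule.span_le]
  intro w hw
  induction hw using Submonoid.closure_induction_left with
  | one => exact Submodule.mem_sup_left ⟨1, map_one (symToU hh)⟩
  | mul_left g hg w hw ih =>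
    obtain ⟨t, ⟨p, rfl⟩, n, hn, rfl⟩ := Submodule.mem_sup.1 ih
    obtain ⟨x, hx | ⟨γ, hγ, hx⟩, -, rfl⟩ := hg
    · rw [mul_add]
      refine Submodule.add_mem_sup ⟨SymmetricAlgebra.ι ℂ h ⟨x, hx⟩ * p, ?_⟩
        (mulW 0 (by simp) _ (ι_cartan_mem_weightU hh ⟨x, hx⟩) _ hn)
      simp [symToU_ι]
    · have hx' := ι_mem_weightU hh hx
      rw [mul_add]
      refine Submodule.mem_sup_right (add_mem (hW' γ hγ ?_) (mulW γ hγ.le _ hx' _ hn))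
      simpa using mul_mem_weightU hx' (symToU_mem_weightU hh p)

/-- Every element of the enveloping algebra has a Harish-Chandra projection. -/
theorem exists_isHarishChandra (hh : IsCartanSubalgebra h) {P : Set (Module.Dual ℂ h)}
    (hP : IsPositiveSystem h P) (u : U L) : ∃ p, IsHarishChandra hh P u p := by
  obtain ⟨φ, hφ, hP⟩ := hP
  obtain ⟨a, ha, k, hk, rfl⟩ := Submodule.mem_sup.1
    (mem_closure_lowerGens_sup_posIdeal hh hφ hP u)
  obtain ⟨t, ⟨p, rfl⟩, n, hn, rfl⟩ := Submodule.mem_sup.1 (span_closure_lowerGens_le hh φ ha)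
  obtain ⟨k₀, h1, h2, h3⟩ := exists_weight_zero_of_mem_posIdeal hh hk
  refine ⟨p, symToU hh p + k₀, add_mem (symToU_mem_weightU hh p) h1, n + (k - k₀), add_mem ?_ h3,
    ?_, by simpa using h2⟩
  · suffices hle : (⨆ μ : {μ : Module.Dual ℂ h // φ μ < 0}, weightU h (μ : Module.Dual ℂ h)) ≤
        ⨆ μ : {μ : Module.Dual ℂ h // μ ≠ 0}, weightU h (μ : Module.Dual ℂ h) from hle hn
    refine iSup_le fun μ => ?_
    have hμ : (μ : Module.Dual ℂ h) ≠ 0 := fun h0 => by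
      have := μ.2
      rw [h0, map_zero] at this
      exact lt_irrefl _ this
    exact le_iSup (fun μ : {μ : Module.Dual ℂ h // μ ≠ 0} => weightU h (μ : Module.Dual ℂ h))
      ⟨μ, hμ⟩
  · simp only [AlgHom.toLinearMap_apply]
    abel

theorem isHarishChandra_harishChandra (hh : IsCartanSubalgebra h) {P : Set (Module.Dual ℂ h)}
    (hP : IsPositiveSystem h P) (u : U L) : IsHarishChandra hh P u (harishChandra hh P u) :=
  Classical.epsilon_spec (exists_isHarishChandra hh hP u)

end HarishChandraExistence

/-! ### Real forms and the ordinary adjoint -/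

section RealStructure

variable {L : Type*} [AddCommGroup L] [Module ℂ L] [LieSuperalgebra L] (σ : RealForm L)

theorem mem_carrier {x : L} : x ∈ σ.carrier ↔ σ.conj x = x := Iff.rfl

/-- A homogeneous element is `x + i y` with `x`, `y` homogeneous in the real form. -/
theorem exists_real_add_I_smul {i : ZMod 2} {x : L} (hx : x ∈ (part i : Submodule ℂ L)) :
    ∃ y z, y ∈ σ.carrier ∧ z ∈ σ.carrier ∧ y ∈ (part i : Submodule ℂ L) ∧
      z ∈ (part i : Submodule ℂ L) ∧ x = y + Complex.I • z := by
  refine ⟨(1 / 2 : ℂ) • (x + σ.conj x), (-Complex.I / 2) • (x - σ.conj x), ?_, ?_,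
    Submodule.smul_mem _ _ (add_mem hx (σ.conj_mem hx)),
    Submodule.smul_mem _ _ (sub_mem hx (σ.conj_mem hx)), ?_⟩
  · rw [mem_carrier, map_smulₛₗ, map_add, σ.conj_conj]
    simp only [map_div₀, map_one, Complex.conj_ofNat]
    module
  · rw [mem_carrier, map_smulₛₗ, map_sub, σ.conj_conj]
    simp only [map_div₀, map_neg, Complex.conj_I, neg_neg, Complex.conj_ofNat]
    module
  · rw [smul_smul, show Complex.I * (-Complex.I / 2) = 1 / 2 by
      linear_combination (-1 / 2 : ℂ) * Complex.I_mul_I]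
    module

theorem dagger_ι_of_mem_carrier {i : ZMod 2} {x : L} (hx : x ∈ (part i : Submodule ℂ L))
    (hσ : x ∈ σ.carrier) : dagger σ (ι L x) = -(Complex.I ^ i.val • ι L x) := by
  rw [mem_carrier] at hσ
  rcases zmod_two_cases i with rfl | rfl
  · simp [dagger_ι_even σ hx, hσ]
  · simp [dagger_ι_odd σ hx, hσ, ZMod.val_one]

theorem dagger_dagger (u : U L) : dagger σ (dagger σ u) = u := by
  induction u using U_induction with
  | hι x =>
    rw [← proj0_add_proj1 x]
    simp only [map_add, dagger_ι_even σ (proj0_mem x), dagger_ι_odd σ (proj1_mem x), map_neg,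
      map_smulₛₗ, dagger_ι_even σ (σ.conj_mem (proj0_mem x)),
      dagger_ι_odd σ (σ.conj_mem (proj1_mem x)), σ.conj_conj, neg_neg, Complex.conj_I, smul_neg,
      smul_smul, neg_mul, Complex.I_mul_I, one_smul]
  | hc c => simp [dagger_algebraMap]
  | hmul a b ha hb => simp only [dagger_mul, ha, hb]
  | hadd a b ha hb => simp only [map_add, ha, hb]

theorem dagger_one : dagger σ (1 : U L) = 1 := by
  simpa using dagger_algebraMap σ (1 : ℂ)

theorem dagger_mem_homogeneous {i : ZMod 2} {a : U L} (ha : a ∈ homogeneous (L := L) i) :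
    dagger σ a ∈ homogeneous (L := L) i := by
  rw [mem_homogeneous] at *
  rw [parity_dagger, ha, map_smulₛₗ]
  simp

end RealStructure

/-! ### The parity grading of a representation -/

section Parity

variable {L : Type*} [AddCommGroup L] [Module ℂ L] [LieSuperalgebra L]
variable {V : Type*} [AddCommGroup V] [Module ℂ V] (π : SuperRep L V)

theorem SuperRep.act_ι (x : L) : π.act (ι L x) = π.toLin x := lift_ι _ _ x

/-- The projection of a super vector space onto its part of parity `i`. -/
def SuperRep.vproj (i : ZMod 2) : V →ₗ[ℂ] V :=
  if i = 0 then (π.vpart 0).projection (π.vpart 1) π.isCompl_vpart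
  else (π.vpart 1).projection (π.vpart 0) π.isCompl_vpart.symm

theorem SuperRep.vproj_mem (i : ZMod 2) (v : V) : π.vproj i v ∈ π.vpart i := by
  rcases zmod_two_cases i with rfl | rfl
  · simp [SuperRep.vproj]
  · simp [SuperRep.vproj]

variable {π} in
theorem SuperRep.vproj_of_mem {i : ZMod 2} {v : V} (hv : v ∈ π.vpart i) : π.vproj i v = v := by
  rcases zmod_two_cases i with rfl | rfl
  · simpa [SuperRep.vproj] using Submodule.projection_apply_of_mem_left π.isCompl_vpart hv
  · simpa [SuperRep.vproj] using Submodule.projection_apply_of_mem_left π.isCompl_vpart.symm hv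

variable {π} in
theorem SuperRep.vproj_of_mem_ne {i j : ZMod 2} (hij : i ≠ j) {v : V} (hv : v ∈ π.vpart j) :
    π.vproj i v = 0 := by
  rcases zmod_two_cases i with rfl | rfl <;> rcases zmod_two_cases j with rfl | rfl
  · exact absurd rfl hij
  · simpa [SuperRep.vproj] using Submodule.projection_apply_of_mem_right π.isCompl_vpart hv
  · simpa [SuperRep.vproj] using Submodule.projection_apply_of_mem_right π.isCompl_vpart.symm hv
  · exact absurd rfl hij

theorem SuperRep.vproj_add_vproj (v : V) : π.vproj 0 v + π.vproj 1 v = v := by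
  obtain ⟨a, b, ha, hb, rfl⟩ := Submodule.codisjoint_iff_exists_add_eq.1
    π.isCompl_vpart.codisjoint v
  simp [SuperRep.vproj_of_mem ha, SuperRep.vproj_of_mem hb,
    SuperRep.vproj_of_mem_ne (one_ne_zero (α := ZMod 2)) ha,
    SuperRep.vproj_of_mem_ne (zero_ne_one (α := ZMod 2)) hb]

theorem SuperRep.mem_vpart_iff {i : ZMod 2} {v : V} :
    v ∈ π.vpart i ↔ π.vproj 0 v - π.vproj 1 v = (-1 : ℂ) ^ i.val • v := by
  refine ⟨fun hv => ?_, fun hv => ?_⟩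
  · rcases zmod_two_cases i with rfl | rfl
    · simp [SuperRep.vproj_of_mem hv, SuperRep.vproj_of_mem_ne (one_ne_zero (α := ZMod 2)) hv]
    · simp [SuperRep.vproj_of_mem hv, SuperRep.vproj_of_mem_ne (zero_ne_one (α := ZMod 2)) hv,
        ZMod.val_one]
  · have e := π.vproj_add_vproj v
    have key : v = π.vproj i v := by
      rcases zmod_two_cases i with rfl | rfl
      · simp only [ZMod.val_zero, pow_zero, one_smul] at hv
        linear_combination (norm := module) (-1 / 2 : ℂ) • hv - (1 / 2 : ℂ) • e
      · simp only [ZMod.val_one, pow_one, neg_smul, one_smul] at hv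
        linear_combination (norm := module) (1 / 2 : ℂ) • hv - (1 / 2 : ℂ) • e
    rw [key]
    exact π.vproj_mem i v

theorem SuperRep.act_mem {i j : ZMod 2} {a : U L} {v : V} (ha : a ∈ homogeneous (L := L) i)
    (hv : v ∈ π.vpart j) : π.act a v ∈ π.vpart (i + j) := by
  -- The grading operator of `V` intertwines the action with the parity automorphism.
  have key : ∀ (a : U L) (v : V), π.vproj 0 (π.act a v) - π.vproj 1 (π.act a v) =
      π.act (parity L a) (π.vproj 0 v - π.vproj 1 v) := by
    intro a
    induction a using U_induction with
    | hι x =>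
      have hom : ∀ (i : ZMod 2) (x : L) (j : ZMod 2) (v : V), x ∈ (part i : Submodule ℂ L) →
          v ∈ π.vpart j → π.vproj 0 (π.act (ι L x) v) - π.vproj 1 (π.act (ι L x) v) =
            π.act (parity L (ι L x)) (π.vproj 0 v - π.vproj 1 v) := by
        intro i x j v hx hv
        have h1 := π.toLin_mem hx hv
        rw [mem_homogeneous.1 (ι_mem_homogeneous hx), π.mem_vpart_iff.1 hv, map_smul, map_smul,
          LinearMap.smul_apply, π.act_ι, π.mem_vpart_iff.1 h1, smul_smul, neg_one_pow_val_add,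
          mul_comm]
      intro v
      rw [← proj0_add_proj1 x, ← π.vproj_add_vproj v]
      have h00 := hom 0 _ 0 _ (proj0_mem x) (π.vproj_mem 0 v)
      have h01 := hom 0 _ 1 _ (proj0_mem x) (π.vproj_mem 1 v)
      have h10 := hom 1 _ 0 _ (proj1_mem x) (π.vproj_mem 0 v)
      have h11 := hom 1 _ 1 _ (proj1_mem x) (π.vproj_mem 1 v)
      simp only [map_add, map_sub, LinearMap.add_apply] at h00 h01 h10 h11 ⊢
      linear_combination (norm := module) h00 + h01 + h10 + h11
    | hc c =>
      intro v
      simp [Algebra.algebraMap_eq_smul_one, smul_sub]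
    | hmul a b ha hb =>
      intro v
      rw [map_mul, map_mul, map_mul, Module.End.mul_apply, Module.End.mul_apply, ha, hb]
    | hadd a b ha hb =>
      intro v
      simp only [map_add, LinearMap.add_apply] at *
      rw [← ha, ← hb]
      abel
  rw [π.mem_vpart_iff, key, mem_homogeneous.1 ha, π.mem_vpart_iff.1 hv, map_smul, map_smul,
    LinearMap.smul_apply, smul_smul, neg_one_pow_val_add, mul_comm]

/-- Every homogeneous vector is the image of a cyclic homogeneous vector under a homogeneous
element of the enveloping algebra. -/
theorem SuperRep.exists_homogeneous_act_eq {i j : ZMod 2} {v w : V} (hv : v ∈ π.vpart j)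
    (hgen : ∀ w, ∃ u, π.act u v = w) (hw : w ∈ π.vpart (i + j)) :
    ∃ a ∈ homogeneous (L := L) i, π.act a v = w := by
  obtain ⟨u, rfl⟩ := hgen w
  obtain ⟨a, ha, rfl⟩ := exists_homogeneous_add u
  refine ⟨a i, ha i, ?_⟩
  have h0 := π.act_mem (ha 0) hv
  have h1 := π.act_mem (ha 1) hv
  have e := SuperRep.vproj_of_mem hw
  rw [map_add, LinearMap.add_apply, map_add] at e
  rcases zmod_two_cases i with rfl | rfl
  · rw [SuperRep.vproj_of_mem h0, SuperRep.vproj_of_mem_ne (by simp) h1, add_zero] at e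
    simpa using e
  · rw [SuperRep.vproj_of_mem h1, SuperRep.vproj_of_mem_ne (by simp) h0, zero_add] at e
    simpa using e

end Parity

/-! ### Highest weight vectors -/

section HighestWeight

variable {L : Type*} [AddCommGroup L] [Module ℂ L] [LieSuperalgebra L] {h : Submodule ℂ L}
variable {V : Type*} [AddCommGroup V] [Module ℂ V] {π : SuperRep L V}
variable {P : Set (Module.Dual ℂ h)} {lam : Module.Dual ℂ h} {v : V}

/-- The weight space of weight `μ` of a representation. -/
def SuperRep.weightSpace (π : SuperRep L V) (h : Submodule ℂ L) (μ : Module.Dual ℂ h) :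
    Submodule ℂ V :=
  ⨅ H : h, (π.toLin H).eigenspace (μ H)

theorem SuperRep.mem_weightSpace {μ : Module.Dual ℂ h} {w : V} :
    w ∈ π.weightSpace h μ ↔ ∀ H : h, π.toLin H w = μ H • w := by
  simp [SuperRep.weightSpace]

theorem SuperRep.act_mem_weightSpace {μ ν : Module.Dual ℂ h} {a : U L} {w : V}
    (ha : a ∈ weightU h μ) (hw : w ∈ π.weightSpace h ν) :
    π.act a w ∈ π.weightSpace h (μ + ν) := by
  rw [SuperRep.mem_weightSpace] at *
  intro H
  have e := congrArg (fun b => π.act b w) (mem_weightU.1 ha H)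
  simp only [map_sub, map_mul, map_smul, LinearMap.sub_apply, Module.End.mul_apply,
    LinearMap.smul_apply, π.act_ι, hw H] at e
  rw [sub_eq_iff_eq_add] at e
  rw [e, LinearMap.add_apply, add_smul]

theorem SuperRep.iSupIndep_weightSpace (hh : IsCartanSubalgebra h) :
    iSupIndep (fun μ : Module.Dual ℂ h => π.weightSpace h μ) := by
  have hcomm : ∀ H K : h, Commute (π.toLin H) (π.toLin K) := by
    intro H K
    have e := ι_mul_sub_mul_ι hh H (K : L)
    rw [hh.bracket_eq_zero H.2 K.2, map_zero, sub_eq_zero] at e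
    have := congrArg π.act e
    rwa [map_mul, map_mul, π.act_ι, π.act_ι] at this
  have ind : iSupIndep fun χ : h → ℂ => ⨅ H : h, (π.toLin (H : L)).maxGenEigenspace (χ H) :=
    Module.End.independent_iInf_maxGenEigenspace_of_forall_mapsTo (fun H : h => π.toLin (H : L))
      fun H K c => Module.End.mapsTo_maxGenEigenspace_of_comm (hcomm K H) c
  have ind' : iSupIndep fun μ : Module.Dual ℂ h =>
      ⨅ H : h, (π.toLin (H : L)).maxGenEigenspace (μ H) :=
    ind.comp (f := fun μ : Module.Dual ℂ h => (fun H => μ H : h → ℂ)) fun μ ν e =>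
      LinearMap.ext fun H => congrFun e H
  refine ind'.mono fun μ => ?_
  exact iInf_mono fun H => Module.End.eigenspace_le_maxGenEigenspace

theorem SuperRep.vproj_mem_weightSpace (hh : IsCartanSubalgebra h) {μ : Module.Dual ℂ h} {w : V}
    (hw : w ∈ π.weightSpace h μ) (i : ZMod 2) : π.vproj i w ∈ π.weightSpace h μ := by
  rw [SuperRep.mem_weightSpace] at *
  intro H
  have h0 := π.toLin_mem (hh.le_even H.2) (π.vproj_mem 0 w)
  have h1 := π.toLin_mem (hh.le_even H.2) (π.vproj_mem 1 w)
  rw [zero_add] at h0 h1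
  have e := congrArg (π.vproj i) (hw H)
  rw [map_smul, ← π.vproj_add_vproj w, map_add, map_add] at e
  rcases zmod_two_cases i with rfl | rfl
  · rw [SuperRep.vproj_of_mem h0, SuperRep.vproj_of_mem_ne zero_ne_one h1, add_zero,
      π.vproj_add_vproj] at e
    exact e
  · rw [SuperRep.vproj_of_mem h1, SuperRep.vproj_of_mem_ne one_ne_zero h0, zero_add,
      π.vproj_add_vproj] at e
    exact e

theorem SuperRep.IsHighestWeightVector.mem_weightSpace
    (hv : π.IsHighestWeightVector h P lam v) : v ∈ π.weightSpace h lam :=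
  SuperRep.mem_weightSpace.2 hv.weight

/-- The coefficient of a homogeneous highest weight vector `v` along the other weight spaces and
the part of the opposite parity. -/
theorem SuperRep.IsHighestWeightVector.exists_coefficient (hh : IsCartanSubalgebra h)
    (hv : π.IsHighestWeightVector h P lam v) {j : ZMod 2} (hj : v ∈ π.vpart j) :
    ∃ l : V →ₗ[ℂ] ℂ, l v = 1 ∧ (∀ μ, μ ≠ lam → ∀ w ∈ π.weightSpace h μ, l w = 0) ∧
      ∀ i, i ≠ j → ∀ w ∈ π.vpart i, l w = 0 := by
  have hdisj := (SuperRep.iSupIndep_weightSpace (π := π) hh) lam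
  have hnot : v ∉ ⨆ μ, ⨆ (_ : μ ≠ lam), π.weightSpace h μ := fun hmem =>
    hv.ne_zero (Submodule.disjoint_def.1 hdisj v hv.mem_weightSpace hmem)
  obtain ⟨f, hf, hle⟩ := Submodule.exists_le_ker_of_notMem hnot
  refine ⟨(f v)⁻¹ • f ∘ₗ π.vproj j, ?_, ?_, ?_⟩
  · simp [SuperRep.vproj_of_mem hj, hf]
  · intro μ hμ w hw
    have : π.vproj j w ∈ LinearMap.ker f := hle
      (Submodule.mem_iSup_of_mem μ (Submodule.mem_iSup_of_mem hμ
        (SuperRep.vproj_mem_weightSpace hh hw j)))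
    simp [LinearMap.mem_ker.1 this]
  · intro i hij w hw
    simp [SuperRep.vproj_of_mem_ne hij.symm hw]

theorem SuperRep.IsHighestWeightVector.act_symToU (hh : IsCartanSubalgebra h)
    (hv : π.IsHighestWeightVector h P lam v) (p : SymmetricAlgebra ℂ h) :
    π.act (symToU hh p) v = evalAt lam p • v := by
  induction p using SymmetricAlgebra.induction with
  | algebraMap r => simp [Algebra.algebraMap_eq_smul_one]
  | ι x => rw [symToU_ι, π.act_ι, hv.weight, evalAt, SymmetricAlgebra.lift_ι_apply]
  | mul a b ha hb =>
    rw [map_mul, map_mul, map_mul, Module.End.mul_apply, hb, map_smul, ha, smul_smul, mul_comm]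
  | add a b ha hb => rw [map_add, map_add, map_add, LinearMap.add_apply, ha, hb, add_smul]

theorem SuperRep.IsHighestWeightVector.act_posIdeal
    (hv : π.IsHighestWeightVector h P lam v) {u : U L} (hu : u ∈ posIdeal h P) :
    π.act u v = 0 := by
  induction hu using Submodule.span_induction with
  | mem u hu =>
    obtain ⟨γ, hγ, x, hx, rfl⟩ := hu
    rw [π.act_ι, hv.annihilated γ hγ x hx]
  | zero => simp
  | add a b _ _ ha hb => rw [map_add, LinearMap.add_apply, ha, hb, add_zero]
  | smul a b _ hb => rw [smul_eq_mul, map_mul, Module.End.mul_apply, hb, map_zero]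

/-- The value `β(u)(lam)` is the coefficient of the highest weight vector `v` in `u v`. -/
theorem SuperRep.IsHighestWeightVector.evalAt_harishChandra (hh : IsCartanSubalgebra h)
    (hP : IsPositiveSystem h P) (hv : π.IsHighestWeightVector h P lam v) {l : V →ₗ[ℂ] ℂ}
    (hlv : l v = 1) (hl : ∀ μ, μ ≠ lam → ∀ w ∈ π.weightSpace h μ, l w = 0) (u : U L) :
    evalAt lam (harishChandra hh P u) = l (π.act u v) := by
  obtain ⟨u₀, -, u₁, hu₁, hu, hK⟩ := isHarishChandra_harishChandra hh hP u
  have h0 := hv.act_posIdeal hK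
  rw [map_sub, LinearMap.sub_apply, hv.act_symToU hh, sub_eq_zero] at h0
  have h1 : l (π.act u₁ v) = 0 := by
    clear hu
    induction hu₁ using Submodule.iSup_induction' with
    | mem μ a ha =>
      refine hl (μ + lam) (fun e => μ.2 (by simpa using e)) _
        (SuperRep.act_mem_weightSpace ha hv.mem_weightSpace)
    | zero => simp
    | add a b _ _ ha hb => rw [map_add, LinearMap.add_apply, map_add, ha, hb, add_zero]
  conv_rhs => rw [hu]
  rw [map_add, LinearMap.add_apply, h0, map_add, h1, map_smul, hlv, smul_eq_mul, mul_one, add_zero]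

/-- For homogeneous `a` the sign factor `(-i)^|a|` turns `a*` into the ordinary adjoint `a†`. -/
theorem SuperRep.IsHighestWeightVector.evalAt_adj_mul (hh : IsCartanSubalgebra h)
    (hP : IsPositiveSystem h P) (hv : π.IsHighestWeightVector h P lam v) {l : V →ₗ[ℂ] ℂ}
    (hlv : l v = 1) (hl : ∀ μ, μ ≠ lam → ∀ w ∈ π.weightSpace h μ, l w = 0) (σ : RealForm L)
    {i : ZMod 2} {a : U L} (ha : a ∈ SuperHC.homogeneous (L := L) i) :
    (-Complex.I) ^ i.val * evalAt lam (harishChandra hh P (adj σ a * a)) =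
      l (π.act (dagger σ a) (π.act a v)) := by
  rw [hv.evalAt_harishChandra hh hP hlv hl, adj_apply_of_mem σ ha, smul_mul_assoc, map_smul,
    map_mul, LinearMap.smul_apply, map_smul, smul_eq_mul, ← mul_assoc, ← mul_pow, neg_mul,
    Complex.I_mul_I, neg_neg, one_pow, one_mul, Module.End.mul_apply]

end HighestWeight

/-! ### Unitarity and ordinary Hermitian forms -/

section Unitarity

variable {L : Type*} [AddCommGroup L] [Module ℂ L] [LieSuperalgebra L]
variable {V : Type*} [AddCommGroup V] [Module ℂ V] {π : SuperRep L V} {σ : RealForm L}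

/-- An ordinary (not super) invariant Hermitian product on a representation: `V₀` and `V₁` are
orthogonal, the form is positive definite on both, and the adjoint of the action of `a` is the
action of `a†`. -/
structure SuperRep.IsInvariantHermitian (π : SuperRep L V) (σ : RealForm L)
    (Φ : V →ₗ[ℂ] V →ₛₗ[starRingEnd ℂ] ℂ) : Prop where
  orthogonal : ∀ i j, i ≠ j → ∀ u ∈ π.vpart i, ∀ w ∈ π.vpart j, Φ u w = 0
  conj_symm : ∀ i, ∀ u ∈ π.vpart i, ∀ w ∈ π.vpart i, Φ u w = starRingEnd ℂ (Φ w u)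
  pos : ∀ i, ∀ u ∈ π.vpart i, u ≠ 0 → 0 < Φ u u
  adjoint : ∀ a u w, Φ (π.act a u) w = Φ u (π.act (dagger σ a) w)

/-- It suffices to check invariance on the homogeneous elements of the real form. -/
theorem SuperRep.adjoint_of_real {Φ : V →ₗ[ℂ] V →ₛₗ[starRingEnd ℂ] ℂ}
    (hΦ : ∀ i j, ∀ X ∈ σ.carrier, X ∈ (part i : Submodule ℂ L) → ∀ u ∈ π.vpart j, ∀ w,
      Φ (π.toLin X u) w = -(starRingEnd ℂ (Complex.I ^ i.val) * Φ u (π.toLin X w)))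
    (a : U L) (u w : V) : Φ (π.act a u) w = Φ u (π.act (dagger σ a) w) := by
  have hreal : ∀ i, ∀ X ∈ σ.carrier, X ∈ (part i : Submodule ℂ L) → ∀ u w,
      Φ (π.act (ι L X) u) w = Φ u (π.act (dagger σ (ι L X)) w) := by
    intro i X hσ hX u w
    rw [dagger_ι_of_mem_carrier σ hX hσ, ← π.vproj_add_vproj u]
    simp only [map_add, LinearMap.add_apply, map_neg, map_smul, LinearMap.neg_apply,
      LinearMap.smul_apply, map_smulₛₗ, smul_eq_mul, π.act_ι,
      hΦ i 0 X hσ hX _ (π.vproj_mem 0 u) w, hΦ i 1 X hσ hX _ (π.vproj_mem 1 u) w]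
    ring
  have hhom : ∀ i, ∀ X ∈ (part i : Submodule ℂ L), ∀ u w,
      Φ (π.act (ι L X) u) w = Φ u (π.act (dagger σ (ι L X)) w) := by
    intro i X hX u w
    obtain ⟨Y, Z, hY, hZ, hYi, hZi, rfl⟩ := exists_real_add_I_smul σ hX
    simp only [map_add, LinearMap.add_apply, map_smul, LinearMap.smul_apply, map_smulₛₗ,
      hreal i Y hY hYi, hreal i Z hZ hZi, Complex.conj_conj]
  induction a using U_induction generalizing u w with
  | hι x =>
    rw [← proj0_add_proj1 x]
    simp only [map_add, LinearMap.add_apply, hhom 0 _ (proj0_mem x), hhom 1 _ (proj1_mem x)]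
  | hc c =>
    rw [dagger_algebraMap]
    simp [Algebra.algebraMap_eq_smul_one]
  | hmul a b ha hb =>
    rw [dagger_mul, map_mul, map_mul, Module.End.mul_apply, Module.End.mul_apply, ha, hb]
  | hadd a b ha hb => simp only [map_add, LinearMap.add_apply, ha, hb]

/-- Unitarity in the super sense is the existence of an ordinary invariant Hermitian product: the
two forms agree on `V₀` and differ by the factor `i` on `V₁`. -/
theorem SuperRep.isUnitary_iff :
    π.IsUnitary σ ↔ ∃ Φ, π.IsInvariantHermitian σ Φ := by
  constructor
  · rintro ⟨B, hsymm, horth, hpos0, hpos1, hinv⟩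
    have hΦ : ∀ j, ∀ u ∈ π.vpart j, ∀ w,
        (B ∘ₗ (π.vproj 0 + Complex.I • π.vproj 1)) u w = Complex.I ^ j.val * B u w := by
      intro j u hu w
      rcases zmod_two_cases j with rfl | rfl
      · simp [SuperRep.vproj_of_mem hu, SuperRep.vproj_of_mem_ne (one_ne_zero (α := ZMod 2)) hu]
      · simp [SuperRep.vproj_of_mem hu, SuperRep.vproj_of_mem_ne (zero_ne_one (α := ZMod 2)) hu,
          ZMod.val_one]
    refine ⟨B ∘ₗ (π.vproj 0 + Complex.I • π.vproj 1), ?_, ?_, ?_, ?_⟩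
    · intro i j hij u hu w hw
      rw [hΦ i u hu, horth i j hij u hu w hw, mul_zero]
    · intro i u hu w hw
      rw [hΦ i u hu, hΦ i w hw, hsymm i i u hu w hw]
      rcases zmod_two_cases i with rfl | rfl <;> simp [sgn, ZMod.val_one]
    · intro i u hu h0
      rw [hΦ i u hu]
      rcases zmod_two_cases i with rfl | rfl
      · simpa using hpos0 u hu h0
      · simpa [ZMod.val_one] using hpos1 u hu h0
    · refine SuperRep.adjoint_of_real fun i j X hσ hX u hu w => ?_
      rw [hΦ _ _ (π.toLin_mem hX hu), hΦ j u hu, hinv i j X hσ hX u hu]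
      rcases zmod_two_cases i with rfl | rfl <;> rcases zmod_two_cases j with rfl | rfl <;>
        simp [sgn, ZMod.val_one, show (1 + 1 : ZMod 2) = 0 by decide, ← mul_assoc]
  · rintro ⟨Φ, horth, hsymm, hpos, hadj⟩
    have hB : ∀ j, ∀ u ∈ π.vpart j, ∀ w,
        (Φ ∘ₗ (π.vproj 0 - Complex.I • π.vproj 1)) u w = (-Complex.I) ^ j.val * Φ u w := by
      intro j u hu w
      rcases zmod_two_cases j with rfl | rfl
      · simp [SuperRep.vproj_of_mem hu, SuperRep.vproj_of_mem_ne (one_ne_zero (α := ZMod 2)) hu]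
      · simp [SuperRep.vproj_of_mem hu, SuperRep.vproj_of_mem_ne (zero_ne_one (α := ZMod 2)) hu,
          ZMod.val_one]
    refine ⟨Φ ∘ₗ (π.vproj 0 - Complex.I • π.vproj 1), ?_, ?_, ?_, ?_, ?_⟩
    · intro i j u hu w hw
      rw [hB i u hu, hB j w hw]
      rcases eq_or_ne i j with rfl | hij
      · rw [hsymm i u hu w hw]
        rcases zmod_two_cases i with rfl | rfl <;> simp [sgn, ZMod.val_one]
      · rw [horth i j hij u hu w hw, horth j i hij.symm w hw u hu]
        simp
    · intro i j hij u hu w hw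
      rw [hB i u hu, horth i j hij u hu w hw, mul_zero]
    · intro u hu h0
      rw [hB 0 u hu]
      simpa using hpos 0 u hu h0
    · intro u hu h0
      rw [hB 1 u hu]
      simpa [ZMod.val_one, ← mul_assoc] using hpos 1 u hu h0
    · intro i j X hσ hX u hu w
      have e := hadj (ι L X) u w
      rw [dagger_ι_of_mem_carrier σ hX hσ, π.act_ι] at e
      simp only [map_neg, map_smul, LinearMap.neg_apply, LinearMap.smul_apply, π.act_ι,
        map_smulₛₗ, smul_eq_mul] at e
      rw [hB _ _ (π.toLin_mem hX hu), hB j u hu, e]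
      rcases zmod_two_cases i with rfl | rfl <;> rcases zmod_two_cases j with rfl | rfl <;>
        simp [sgn, ZMod.val_one, show (1 + 1 : ZMod 2) = 0 by decide, ← mul_assoc]

end Unitarity

/-! ### Nonnegative sesquilinear forms -/

section Hermitian

variable {V : Type*} [AddCommGroup V] [Module ℂ V]

/-- Polarization: a sesquilinear form that is nonnegative on a complex subspace is Hermitian
there. -/
theorem conj_symm_of_nonneg (Φ : V →ₗ[ℂ] V →ₛₗ[starRingEnd ℂ] ℂ) (S : Submodule ℂ V)
    (hΦ : ∀ x ∈ S, 0 ≤ Φ x x) {x y : V} (hx : x ∈ S) (hy : y ∈ S) :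
    Φ x y = starRingEnd ℂ (Φ y x) := by
  have him : ∀ z ∈ S, (Φ z z).im = 0 := fun z hz => ((Complex.nonneg_iff.1 (hΦ z hz)).2).symm
  have h1 := him _ (add_mem hx hy)
  have h2 := him _ (add_mem hx (S.smul_mem Complex.I hy))
  have hx' := him x hx
  have hy' := him y hy
  simp only [map_add, map_smul, map_smulₛₗ, LinearMap.add_apply, LinearMap.smul_apply, smul_eq_mul,
    Complex.add_im, Complex.add_re, Complex.mul_im, Complex.mul_re, Complex.conj_I,
    Complex.neg_re, Complex.neg_im,
    Complex.I_re, Complex.I_im] at h1 h2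
  apply Complex.ext
  · rw [Complex.conj_re]
    linarith
  · rw [Complex.conj_im]
    linarith

/-- A vector of length `0` of a nonnegative form is in its radical. -/
theorem eq_zero_of_nonneg (Φ : V →ₗ[ℂ] V →ₛₗ[starRingEnd ℂ] ℂ) (S : Submodule ℂ V)
    (hΦ : ∀ x ∈ S, 0 ≤ Φ x x) {x y : V} (hx : x ∈ S) (hy : y ∈ S) (h0 : Φ x x = 0) :
    Φ x y = 0 := by
  have hsymm := conj_symm_of_nonneg Φ S hΦ hy hx
  set c := Φ x y with hc
  -- The value of the form at `y - s c̄ x` is affine in `s`, with slope `-2|c|²`.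
  have key : ∀ s : ℝ, 0 ≤ (Φ y y).re - 2 * s * Complex.normSq c := by
    intro s
    have h1 := (Complex.nonneg_iff.1
      (hΦ _ (add_mem hy (S.smul_mem (-(s : ℂ) * starRingEnd ℂ c) hx)))).1
    simp only [map_add, map_smul, map_smulₛₗ, LinearMap.add_apply, LinearMap.smul_apply,
      smul_eq_mul, h0, ← hc, hsymm, map_mul, map_neg, Complex.conj_ofReal, Complex.conj_conj] at h1
    simp only [mul_zero, add_zero, Complex.add_re, Complex.mul_re, Complex.neg_re,
      Complex.ofReal_re, Complex.conj_re, Complex.conj_im, Complex.neg_im, Complex.ofReal_im,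
      Complex.mul_im] at h1
    rw [Complex.normSq_apply]
    linarith
  by_contra hne
  have hpos : 0 < Complex.normSq c := Complex.normSq_pos.2 hne
  have := key (((Φ y y).re + 1) / (2 * Complex.normSq c))
  have e : 2 * (((Φ y y).re + 1) / (2 * Complex.normSq c)) * Complex.normSq c =
      (Φ y y).re + 1 := by
    field_simp
  linarith

end Hermitian

/-! ### Unitary highest weight representations -/

section HighestWeightUnitarity

variable {L : Type*} [AddCommGroup L] [Module ℂ L] [LieSuperalgebra L] {h : Submodule ℂ L}
variable {V : Type*} [AddCommGroup V] [Module ℂ V] {π : SuperRep L V} {σ : RealForm L}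
variable {P : Set (Module.Dual ℂ h)} {lam : Module.Dual ℂ h} {v : V}

/-- Weight vectors of other weights are orthogonal to the highest weight vector. -/
theorem SuperRep.IsInvariantHermitian.eq_zero_of_weight (hh : IsCartanSubalgebra h)
    (hreal : ∀ x ∈ h, σ.conj x ∈ h) {Φ : V →ₗ[ℂ] V →ₛₗ[starRingEnd ℂ] ℂ}
    (hΦ : π.IsInvariantHermitian σ Φ) (hv : π.IsHighestWeightVector h P lam v)
    {μ : Module.Dual ℂ h} (hμ : μ ≠ lam) {w : V} (hw : w ∈ π.weightSpace h μ) : Φ w v = 0 := by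
  obtain ⟨j, hj⟩ := hv.homogeneous
  have hvv := (hΦ.pos j v hj hv.ne_zero).ne'
  rw [SuperRep.mem_weightSpace] at hw
  have move : ∀ (H : h) (u : V), Φ (π.toLin H u) v =
      -starRingEnd ℂ (lam ⟨_, hreal H H.2⟩) * Φ u v := by
    intro H u
    have e := hΦ.adjoint (ι L H) u v
    rw [dagger_ι_even σ (hh.le_even H.2), π.act_ι, map_neg, LinearMap.neg_apply, π.act_ι] at e
    rw [e, hv.weight ⟨_, hreal H H.2⟩, map_neg, map_smulₛₗ, smul_eq_mul, neg_mul]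
  obtain ⟨H, hH⟩ : ∃ H, μ H ≠ lam H := by
    by_contra! hall
    exact hμ (LinearMap.ext hall)
  have e1 := move H w
  have e2 := move H v
  rw [hw H, map_smul, LinearMap.smul_apply, smul_eq_mul] at e1
  rw [hv.weight H, map_smul, LinearMap.smul_apply, smul_eq_mul] at e2
  rw [← mul_right_cancel₀ hvv e2] at e1
  by_contra h0
  exact hH (mul_right_cancel₀ h0 e1)

/-- In a unitary highest weight representation `β(a† a)(lam)` is the squared length of `a v` divided
by that of `v`. -/
theorem SuperRep.IsInvariantHermitian.evalAt_adj_mul (hh : IsCartanSubalgebra h)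
    (hreal : ∀ x ∈ h, σ.conj x ∈ h) (hP : IsPositiveSystem h P)
    {Φ : V →ₗ[ℂ] V →ₛₗ[starRingEnd ℂ] ℂ} (hΦ : π.IsInvariantHermitian σ Φ)
    (hv : π.IsHighestWeightVector h P lam v) {i : ZMod 2} {a : U L}
    (ha : a ∈ homogeneous (L := L) i) :
    (-Complex.I) ^ i.val * evalAt lam (harishChandra hh P (adj σ a * a)) =
      (Φ v v)⁻¹ * Φ (π.act a v) (π.act a v) := by
  obtain ⟨j, hj⟩ := hv.homogeneous
  have hvv := (hΦ.pos j v hj hv.ne_zero).ne'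
  have hl : ∀ w, ((Φ v v)⁻¹ • Φ.flip v) w = (Φ v v)⁻¹ * Φ w v := fun w => rfl
  rw [hv.evalAt_adj_mul hh hP (l := (Φ v v)⁻¹ • Φ.flip v) (by rw [hl, inv_mul_cancel₀ hvv])
    (fun μ hμ w hw => by rw [hl, hΦ.eq_zero_of_weight hh hreal hv hμ hw, mul_zero]) σ ha, hl,
    hΦ.adjoint, dagger_dagger]

/-- Nonnegativity of `β(a† a)(lam)` makes `(a v, b v) = β(b† a)(lam)` an invariant Hermitian
product. It descends from the enveloping algebra to `V` since it is Hermitian, and its radical is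
an invariant graded subspace that does not contain `v`. -/
theorem SuperRep.IsHighestWeightVector.exists_isInvariantHermitian (hh : IsCartanSubalgebra h)
    (hP : IsPositiveSystem h P) (hπ : π.IsIrreducible) (hv : π.IsHighestWeightVector h P lam v)
    (hpos : ∀ (i : ZMod 2), ∀ a ∈ SuperHC.homogeneous (L := L) i,
      0 ≤ (-Complex.I) ^ i.val * evalAt lam (harishChandra hh P (adj σ a * a))) :
    ∃ Φ, π.IsInvariantHermitian σ Φ := by
  obtain ⟨j, hj⟩ := hv.homogeneous
  obtain ⟨l, hlv, hlw, hlj⟩ := hv.exists_coefficient hh hj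
  -- The form `F a b = l (b† a v)` on the enveloping algebra.
  let F : U L →ₗ[ℂ] U L →ₛₗ[starRingEnd ℂ] ℂ := LinearMap.mk₂'ₛₗ _ _
    (fun a b => l (π.act (dagger σ b) (π.act a v)))
    (by intro a b c; simp) (by intro c a b; simp) (by intro a b c; simp) (by intro c a b; simp)
  have hF : ∀ a b, F a b = l (π.act (dagger σ b) (π.act a v)) := fun a b => rfl
  have hF0 : ∀ i, ∀ a ∈ SuperHC.homogeneous (L := L) i, 0 ≤ F a a := by
    intro i a ha
    rw [hF, ← hv.evalAt_adj_mul hh hP hlv hlw σ ha]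
    exact hpos i a ha
  have hFne : ∀ i k, i ≠ k → ∀ a ∈ SuperHC.homogeneous (L := L) i,
      ∀ b ∈ SuperHC.homogeneous (L := L) k, F a b = 0 := by
    intro i k hik a ha b hb
    rw [hF]
    refine hlj (k + (i + j)) (fun e => hik ?_) _
      (π.act_mem (dagger_mem_homogeneous σ hb) (π.act_mem ha hj))
    rw [← add_assoc, add_eq_right] at e
    exact (by decide : ∀ i k : ZMod 2, k + i = 0 → i = k) i k e
  have hFsymm : ∀ a b, F a b = starRingEnd ℂ (F b a) := by
    intro a b
    obtain ⟨a, ha, rfl⟩ := exists_homogeneous_add a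
    obtain ⟨b, hb, rfl⟩ := exists_homogeneous_add b
    simp only [map_add, LinearMap.add_apply,
      hFne 0 1 zero_ne_one _ (ha 0) _ (hb 1), hFne 1 0 one_ne_zero _ (ha 1) _ (hb 0),
      hFne 0 1 zero_ne_one _ (hb 0) _ (ha 1), hFne 1 0 one_ne_zero _ (hb 1) _ (ha 0),
      conj_symm_of_nonneg F _ (hF0 0) (ha 0) (hb 0), conj_symm_of_nonneg F _ (hF0 1) (ha 1) (hb 1),
      add_zero, zero_add]
  -- Descend to `V` along a linear section of `a ↦ a v`.
  obtain ⟨s, hs⟩ := LinearMap.exists_rightInverse_of_surjective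
    ((LinearMap.applyₗ v) ∘ₗ π.act.toLinearMap) (LinearMap.range_eq_top.2 hv.generates)
  have hs' : ∀ w, π.act (s w) v = w := fun w => LinearMap.congr_fun hs w
  let Φ : V →ₗ[ℂ] V →ₛₗ[starRingEnd ℂ] ℂ := LinearMap.mk₂'ₛₗ _ _ (fun u w => F (s u) (s w))
    (by intro a b c; simp) (by intro c a b; simp) (by intro a b c; simp) (by intro c a b; simp)
  have hΦs : ∀ u w, Φ u w = F (s u) (s w) := fun u w => rfl
  have hΦF : ∀ a b, Φ (π.act a v) (π.act b v) = F a b := by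
    intro a b
    rw [hΦs, hF, hs', ← hF, hFsymm, hF, hs', ← hF, ← hFsymm]
  have hΦadj : ∀ a u w, Φ (π.act a u) w = Φ u (π.act (dagger σ a) w) := by
    intro a u w
    obtain ⟨b, rfl⟩ := hv.generates u
    obtain ⟨c, rfl⟩ := hv.generates w
    rw [← Module.End.mul_apply, ← map_mul, ← Module.End.mul_apply, ← map_mul, hΦF, hΦF, hF, hF,
      dagger_mul, dagger_dagger, map_mul, map_mul, Module.End.mul_apply, Module.End.mul_apply]
  have hlift : ∀ i, ∀ u ∈ π.vpart i, ∃ a ∈ SuperHC.homogeneous (L := L) (i - j),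
      π.act a v = u := fun i u hu =>
    π.exists_homogeneous_act_eq hj hv.generates (by rwa [sub_add_cancel])
  have horth : ∀ i k, i ≠ k → ∀ u ∈ π.vpart i, ∀ w ∈ π.vpart k, Φ u w = 0 := by
    intro i k hik u hu w hw
    obtain ⟨a, ha, rfl⟩ := hlift i u hu
    obtain ⟨b, hb, rfl⟩ := hlift k w hw
    rw [hΦF, hFne _ _ (fun e => hik (sub_left_injective e)) a ha b hb]
  have hnonneg : ∀ i, ∀ u ∈ π.vpart i, 0 ≤ Φ u u := by
    intro i u hu
    obtain ⟨a, ha, rfl⟩ := hlift i u hu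
    rw [hΦF]
    exact hF0 _ a ha
  have hrad : LinearMap.ker Φ = ⊥ := by
    refine (hπ.2 (LinearMap.ker Φ) (le_antisymm ?_ (sup_le inf_le_left inf_le_left))
      ?_).resolve_right ?_
    · intro u hu
      have hproj : ∀ i, π.vproj i u ∈ LinearMap.ker Φ := by
        intro i
        rw [LinearMap.mem_ker] at hu ⊢
        have hu' := fun w => LinearMap.congr_fun hu w
        simp only [LinearMap.zero_apply] at hu'
        have e : ∀ w ∈ π.vpart i, Φ (π.vproj i u) w = Φ u w := by
          intro w hw
          conv_rhs => rw [← π.vproj_add_vproj u]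
          rw [map_add, LinearMap.add_apply]
          rcases zmod_two_cases i with rfl | rfl
          · rw [horth 1 0 one_ne_zero _ (π.vproj_mem 1 u) w hw, add_zero]
          · rw [horth 0 1 zero_ne_one _ (π.vproj_mem 0 u) w hw, zero_add]
        ext w
        rw [LinearMap.zero_apply, ← π.vproj_add_vproj w, map_add]
        rcases zmod_two_cases i with rfl | rfl
        · rw [e _ (π.vproj_mem 0 w), hu',
            horth 0 1 zero_ne_one _ (π.vproj_mem 0 u) _ (π.vproj_mem 1 w), add_zero]
        · rw [e _ (π.vproj_mem 1 w), hu',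
            horth 1 0 one_ne_zero _ (π.vproj_mem 1 u) _ (π.vproj_mem 0 w), add_zero]
      rw [← π.vproj_add_vproj u]
      exact Submodule.add_mem_sup ⟨hproj 0, π.vproj_mem 0 u⟩ ⟨hproj 1, π.vproj_mem 1 u⟩
    · intro x w hw
      rw [LinearMap.mem_ker] at hw ⊢
      ext u
      rw [← π.act_ι, hΦadj, hw, LinearMap.zero_apply, LinearMap.zero_apply]
    · intro htop
      have hmem : v ∈ LinearMap.ker Φ := htop ▸ Submodule.mem_top
      have e := LinearMap.congr_fun (LinearMap.mem_ker.1 hmem) v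
      have e' := hΦF 1 1
      rw [hF, dagger_one] at e'
      simp only [map_one, Module.End.one_apply, hlv] at e'
      rw [e'] at e
      exact one_ne_zero e
  refine ⟨Φ, horth, fun i u hu w hw => conj_symm_of_nonneg Φ _ (hnonneg i) hu hw,
    fun i u hu h0 => lt_of_le_of_ne (hnonneg i u hu) fun e => h0 ?_, hΦadj⟩
  rw [← Submodule.mem_bot ℂ, ← hrad, LinearMap.mem_ker]
  ext w
  rw [← π.vproj_add_vproj w, map_add, LinearMap.zero_apply]
  rcases zmod_two_cases i with rfl | rfl
  · rw [eq_zero_of_nonneg Φ _ (hnonneg 0) hu (π.vproj_mem 0 w) e.symm,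
      horth 0 1 zero_ne_one u hu _ (π.vproj_mem 1 w), add_zero]
  · rw [eq_zero_of_nonneg Φ _ (hnonneg 1) hu (π.vproj_mem 1 w) e.symm,
      horth 1 0 one_ne_zero u hu _ (π.vproj_mem 0 w), add_zero]

end HighestWeightUnitarity

/-! ### The Hermitian product of a Cartan decomposition -/

section Cartan

variable {L : Type*} [AddCommGroup L] [Module ℂ L] [LieSuperalgebra L] {σ : RealForm L}

theorem RealForm.conj_mem_span {S : Submodule ℝ L} (hS : S ≤ σ.carrier) {x : L}
    (hx : x ∈ Submodule.span ℂ (S : Set L)) : σ.conj x ∈ Submodule.span ℂ (S : Set L) := by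
  induction hx using Submodule.span_induction with
  | mem x hx => rw [(mem_carrier σ).1 (hS hx)]; exact Submodule.subset_span hx
  | zero => simp
  | add x y _ _ hx hy => rw [map_add]; exact add_mem hx hy
  | smul c x _ hx => rw [map_smulₛₗ]; exact Submodule.smul_mem _ _ hx

theorem CartanDecomposition.k_le_even (D : CartanDecomposition σ) : D.k ≤ σ.even :=
  D.sup_eq ▸ le_sup_left

theorem CartanDecomposition.p_le_even (D : CartanDecomposition σ) : D.p ≤ σ.even :=
  D.sup_eq ▸ le_sup_right

/-- The sesquilinear extension `Ψ` to `L` of a real bilinear form on the real form, with the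
projections `re` and `im` of `L` to the real form, which commute with `ad X` for real `X`. -/
theorem RealForm.exists_sesquilinear_extension (σ : RealForm L) (B : L →ₗ[ℝ] L →ₗ[ℝ] ℝ) :
    ∃ (re im : L →ₗ[ℝ] L) (Ψ : L →ₗ[ℂ] L →ₛₗ[starRingEnd ℂ] ℂ),
      (∀ x, re x ∈ σ.carrier) ∧ (∀ x, im x ∈ σ.carrier) ∧ (∀ x, x = re x + Complex.I • im x) ∧
      (∀ X ∈ σ.carrier, ∀ x, re (bracket X x) = bracket X (re x) ∧
        im (bracket X x) = bracket X (im x)) ∧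
      (∀ x y, Ψ x y = ((B (re x) (re y) + B (im x) (im y) : ℝ) : ℂ) +
        Complex.I * ((B (im x) (re y) - B (re x) (im y) : ℝ) : ℂ)) := by
  have hsm : ∀ (c : ℝ) (x : L), σ.conj (c • x) = c • σ.conj x := by
    intro c x
    rw [← Complex.coe_smul, map_smulₛₗ, Complex.conj_ofReal, Complex.coe_smul]
  let re : L →ₗ[ℝ] L :=
    { toFun x := (1 / 2 : ℂ) • (x + σ.conj x)
      map_add' x y := by rw [map_add]; module
      map_smul' c x := by rw [hsm, ← smul_add, RingHom.id_apply, smul_comm] }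
  let im : L →ₗ[ℝ] L :=
    { toFun x := (-Complex.I / 2 : ℂ) • (x - σ.conj x)
      map_add' x y := by rw [map_add]; module
      map_smul' c x := by rw [hsm, ← smul_sub, RingHom.id_apply, smul_comm] }
  have hre : ∀ x, re x = (1 / 2 : ℂ) • (x + σ.conj x) := fun x => rfl
  have him : ∀ x, im x = (-Complex.I / 2 : ℂ) • (x - σ.conj x) := fun x => rfl
  have hreI : ∀ (c : ℂ) x, re (c • x) = c.re • re x - c.im • im x := by
    intro c x
    rw [hre, hre, him, map_smulₛₗ, ← Complex.coe_smul c.re, ← Complex.coe_smul c.im]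
    conv_lhs => rw [← Complex.re_add_im c]
    simp only [map_add, map_mul, Complex.conj_ofReal, Complex.conj_I]
    module
  have himI : ∀ (c : ℂ) x, im (c • x) = c.im • re x + c.re • im x := by
    intro c x
    rw [him, hre, him, map_smulₛₗ, ← Complex.coe_smul c.re, ← Complex.coe_smul c.im]
    conv_lhs => rw [← Complex.re_add_im c]
    simp only [map_add, map_mul, Complex.conj_ofReal, Complex.conj_I]
    match_scalars
    · linear_combination (-(c.im : ℂ) / 2) * Complex.I_mul_I
    · linear_combination (-(c.im : ℂ) / 2) * Complex.I_mul_I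
  let Ψ : L →ₗ[ℂ] L →ₛₗ[starRingEnd ℂ] ℂ := LinearMap.mk₂'ₛₗ _ _
    (fun x y => ((B (re x) (re y) + B (im x) (im y) : ℝ) : ℂ) +
        Complex.I * ((B (im x) (re y) - B (re x) (im y) : ℝ) : ℂ))
    (by
      intro a b c
      simp only [map_add, LinearMap.add_apply]
      push_cast
      ring)
    (by
      intro c a b
      simp only [hreI, himI, map_add, map_sub, map_smul, LinearMap.add_apply, LinearMap.sub_apply,
        LinearMap.smul_apply, smul_eq_mul, RingHom.id_apply]
      apply Complex.ext <;> simp <;> ring)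
    (by
      intro a b c
      simp only [map_add]
      push_cast
      ring)
    (by
      intro c a b
      simp only [hreI, himI, map_add, map_sub, map_smul, smul_eq_mul]
      apply Complex.ext <;> simp <;> ring)
  refine ⟨re, im, Ψ, ?_, ?_, ?_, ?_, fun x y => rfl⟩
  · intro x
    rw [mem_carrier, hre, map_smulₛₗ, map_add, σ.conj_conj]
    simp only [map_div₀, map_one, Complex.conj_ofNat]
    module
  · intro x
    rw [mem_carrier, him, map_smulₛₗ, map_sub, σ.conj_conj]
    simp only [map_div₀, map_neg, Complex.conj_I, neg_neg, Complex.conj_ofNat]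
    module
  · intro x
    rw [hre, him, smul_smul, show Complex.I * (-Complex.I / 2) = 1 / 2 by
      linear_combination (-1 / 2 : ℂ) * Complex.I_mul_I]
    module
  · intro X hX x
    rw [mem_carrier] at hX
    rw [hre, hre, him, him, σ.conj_bracket, hX]
    simp only [map_smul, map_add, map_sub, and_self]

/-- The Hermitian product on `L` that extends the inner product of a Cartan decomposition:
`ad X` has adjoint `-ad σ(X)` for `X ∈ k_ℂ` and `ad σ(X)` for `X ∈ (p₀)_ℂ`. -/
theorem CartanDecomposition.exists_hermitian (D : CartanDecomposition σ) :
    ∃ Ψ : L →ₗ[ℂ] L →ₛₗ[starRingEnd ℂ] ℂ, (∀ x, x ≠ 0 → 0 < Ψ x x) ∧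
      (∀ X ∈ D.kC, ∀ x y, Ψ (bracket X x) y = -Ψ x (bracket (σ.conj X) y)) ∧
      (∀ X ∈ D.pC, ∀ x y, Ψ (bracket X x) y = Ψ x (bracket (σ.conj X) y)) := by
  obtain ⟨B, hsymm, hpos, hk, hp⟩ := D.exists_inner
  obtain ⟨re, im, Ψ, hre, him, hx, hbr, hΨ⟩ := σ.exists_sesquilinear_extension B
  -- Invariance extends from a real subspace of the real form to its complex span.
  have ext : ∀ (S : Submodule ℝ L) (ε : ℂ), S ≤ σ.carrier →
      (∀ X ∈ S, ∀ x y, Ψ (bracket X x) y = ε * Ψ x (bracket X y)) →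
      ∀ X ∈ Submodule.span ℂ (S : Set L), ∀ x y,
        Ψ (bracket X x) y = ε * Ψ x (bracket (σ.conj X) y) := by
    intro S ε hS h X hX x y
    induction hX using Submodule.span_induction with
    | mem X hX => rw [(mem_carrier σ).1 (hS hX), h X hX]
    | zero => simp
    | add X Y _ _ hX hY =>
      simp only [map_add, LinearMap.add_apply, hX, hY, mul_add]
    | smul c X _ hX =>
      simp only [map_smul, map_smulₛₗ, LinearMap.smul_apply, hX, smul_eq_mul, Complex.conj_conj]
      ring
  refine ⟨Ψ, ?_, ?_, ?_⟩
  · intro x h0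
    have e : Ψ x x = ((B (re x) (re x) + B (im x) (im x) : ℝ) : ℂ) := by
      rw [hΨ, hsymm _ (him x) _ (hre x)]
      simp
    rw [e, Complex.zero_lt_real]
    have nonneg : ∀ y ∈ σ.carrier, 0 ≤ B y y := fun y hy => by
      by_cases hy0 : y = 0
      · simp [hy0]
      · exact (hpos y hy hy0).le
    by_cases hr : re x = 0
    · have hi : im x ≠ 0 := fun hi => h0 (by rw [hx x, hr, hi]; simp)
      exact add_pos_of_nonneg_of_pos (nonneg _ (hre x)) (hpos _ (him x) hi)
    · exact add_pos_of_pos_of_nonneg (hpos _ (hre x) hr) (nonneg _ (him x))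
  · intro X hX x y
    have hS : D.k ≤ σ.carrier := D.k_le_even.trans inf_le_left
    rw [ext D.k (-1) hS ?_ X hX, neg_one_mul]
    intro X hX x y
    have b := hbr X (hS hX)
    rw [hΨ, hΨ, (b x).1, (b x).2, (b y).1, (b y).2, hk X hX _ (hre x) _ (hre y),
      hk X hX _ (him x) _ (him y), hk X hX _ (him x) _ (hre y), hk X hX _ (hre x) _ (him y)]
    push_cast
    ring
  · intro X hX x y
    have hS : D.p ≤ σ.carrier := D.p_le_even.trans inf_le_left
    rw [ext D.p 1 hS ?_ X hX, one_mul]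
    intro X hX x y
    have b := hbr X (hS hX)
    rw [hΨ, hΨ, (b x).1, (b x).2, (b y).1, (b y).2, hp X hX _ (hre x) _ (hre y),
      hp X hX _ (him x) _ (him y), hp X hX _ (him x) _ (hre y), hp X hX _ (hre x) _ (him y)]
    push_cast
    ring

end Cartan

/-! ### Signs of coroots -/

section Coroots

variable {L : Type*} [AddCommGroup L] [Module ℂ L] [LieSuperalgebra L] {σ : RealForm L}
variable {h : Submodule ℂ L}

theorem bracket_skew_even {x y : L} (hx : x ∈ (part 0 : Submodule ℂ L))
    (hy : y ∈ (part 0 : Submodule ℂ L)) : bracket x y = -bracket y x := by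
  simpa [sgn] using skew hx hy

/-- Roots are imaginary on `h ∩ k`, so complex conjugation maps `g_α` to `g_{-α}`. -/
theorem conj_mem_rootSpace_neg {Ψ : L →ₗ[ℂ] L →ₛₗ[starRingEnd ℂ] ℂ}
    (hpos : ∀ x, x ≠ 0 → 0 < Ψ x x)
    (hadj : ∀ X ∈ h, ∀ x y, Ψ (bracket X x) y = -Ψ x (bracket (σ.conj X) y))
    (hreal : ∀ x ∈ h, σ.conj x ∈ h) {α : Module.Dual ℂ h} {x : L} (hx : x ∈ rootSpace h α) :
    σ.conj x ∈ rootSpace h (-α) := by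
  by_cases h0 : x = 0
  · simp [h0]
  have hxx := (hpos x h0).ne'
  intro H
  have e := hadj H H.2 x x
  have e1 := mem_rootSpace.1 hx ⟨_, hreal H H.2⟩
  simp only at e1
  rw [mem_rootSpace.1 hx H, e1, map_smul, map_smulₛₗ, LinearMap.smul_apply, smul_eq_mul,
    smul_eq_mul, ← neg_mul] at e
  have e2 := mul_right_cancel₀ hxx e
  have e3 := congrArg σ.conj e1
  rw [σ.conj_bracket, σ.conj_conj, map_smulₛₗ] at e3
  rw [e3, LinearMap.neg_apply, e2, neg_neg]

/-- The sign of a coroot. If `ad X` has adjoint `ε ad σ(X)` for all `X` in a root space `g_α`, then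
`([x, σ(z)], H) = ε conj(α(H)) (x, z)` for `x, z ∈ g_α` and `H ∈ h`. So every `[x, σ(z)]`, and with
it the coroot, is proportional to `[e, σ(e)]` for any nonzero `e ∈ g_α`; and `H = [e, σ(e)]` shows
that `α([e, σ(e)])` has the sign of `ε`. -/
theorem exists_smul_bracket_conj_eq_coroot (hh : IsCartanSubalgebra h)
    {Ψ : L →ₗ[ℂ] L →ₛₗ[starRingEnd ℂ] ℂ} (hpos : ∀ x, x ≠ 0 → 0 < Ψ x x)
    (hadj : ∀ X ∈ h, ∀ x y, Ψ (bracket X x) y = -Ψ x (bracket (σ.conj X) y))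
    (hreal : ∀ x ∈ h, σ.conj x ∈ h) {α : Module.Dual ℂ h} {S : Submodule ℂ L}
    (hS0 : S ≤ part 0) (hSσ : ∀ x ∈ S, σ.conj x ∈ S) {ε : ℂ}
    (hε : ∀ X ∈ S, ∀ x y, Ψ (bracket X x) y = ε * Ψ x (bracket (σ.conj X) y))
    (hαS : rootSpace h α ≤ S) {e : L} (he : e ∈ rootSpace h α) (he0 : e ≠ 0) :
    ∃ h₀ : h, (h₀ : L) = bracket e (σ.conj e) ∧
      Ψ h₀ h₀ = ε * starRingEnd ℂ (α h₀) * Ψ e e ∧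
      ∀ H, IsCoroot h α H → ∃ c : ℂ, H = c • h₀ := by
  have hneg : ∀ {β : Module.Dual ℂ h} {x : L}, x ∈ rootSpace h β → σ.conj x ∈ rootSpace h (-β) :=
    fun hx => conj_mem_rootSpace_neg hpos hadj hreal hx
  have hmem : ∀ x ∈ rootSpace h α, ∀ z ∈ rootSpace h α, bracket x (σ.conj z) ∈ h := by
    intro x hx z hz
    rw [← hh.rootSpace_zero]
    intro H
    rw [jacobi _ (hh.le_even H.2) (hS0 (hαS hx)), mem_rootSpace.1 hx H,
      mem_rootSpace.1 (hneg hz) H]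
    simp [sgn]
  have hpair : ∀ x ∈ rootSpace h α, ∀ z ∈ rootSpace h α, ∀ H : h,
      Ψ (bracket x (σ.conj z)) H = ε * starRingEnd ℂ (α H) * Ψ x z := by
    intro x hx z hz H
    rw [bracket_skew_even (hS0 (hαS hx)) (hS0 (hSσ _ (hαS hz))), map_neg, LinearMap.neg_apply,
      hε _ (hSσ _ (hαS hz)), σ.conj_conj, bracket_skew_even (hS0 (hαS hz)) (hh.le_even H.2),
      mem_rootSpace.1 hz H, map_neg, map_smulₛₗ, smul_eq_mul]
    ring
  have hprop : ∀ x ∈ rootSpace h α, ∀ z ∈ rootSpace h α,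
      Ψ e e • bracket x (σ.conj z) = Ψ x z • bracket e (σ.conj e) := by
    intro x hx z hz
    by_contra hne
    have hd := hpos _ (sub_ne_zero.2 hne)
    have hdh : Ψ e e • bracket x (σ.conj z) - Ψ x z • bracket e (σ.conj e) ∈ h :=
      sub_mem (h.smul_mem _ (hmem x hx z hz)) (h.smul_mem _ (hmem e he e he))
    set d := Ψ e e • bracket x (σ.conj z) - Ψ x z • bracket e (σ.conj e) with hd'
    have e1 := hpair x hx z hz ⟨d, hdh⟩
    have e2 := hpair e he e he ⟨d, hdh⟩
    simp only at e1 e2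
    have hlin : ∀ y, Ψ d y = Ψ e e * Ψ (bracket x (σ.conj z)) y -
        Ψ x z * Ψ (bracket e (σ.conj e)) y := fun y => by
      rw [hd', map_sub, LinearMap.sub_apply, map_smul, map_smul, LinearMap.smul_apply,
        LinearMap.smul_apply, smul_eq_mul, smul_eq_mul]
    have : Ψ d d = 0 := by
      rw [hlin, e1, e2]
      ring
    exact hd.ne' this
  refine ⟨⟨_, hmem e he e he⟩, rfl, hpair e he e he ⟨_, hmem e he e he⟩, ?_⟩
  rintro H ⟨-, hH⟩
  have hspan : (H : L) ∈ Submodule.span ℂ {bracket e (σ.conj e)} := by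
    refine Submodule.span_le.2 ?_ hH
    rintro _ ⟨x, hx, y, hy, rfl⟩
    have hy' := hneg hy
    rw [neg_neg] at hy'
    have e1 := hprop x hx _ hy'
    rw [σ.conj_conj] at e1
    refine Submodule.mem_span_singleton.2 ⟨(Ψ e e)⁻¹ * Ψ x (σ.conj y), ?_⟩
    rw [mul_smul, ← e1, smul_smul, inv_mul_cancel₀ (hpos e he0).ne', one_smul]
  obtain ⟨c, hc⟩ := Submodule.mem_span_singleton.1 hspan
  exact ⟨c, Subtype.ext hc.symm⟩

variable {V : Type*} [AddCommGroup V] [Module ℂ V] {π : SuperRep L V}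
variable {P : Set (Module.Dual ℂ h)} {lam : Module.Dual ℂ h} {v : V}

/-- The squared length of `σ(e) v` for an even positive root vector `e` is `-lam([e, σ(e)])` times
that of `v`. -/
theorem SuperRep.IsInvariantHermitian.bracket_conj_nonpos {Φ : V →ₗ[ℂ] V →ₛₗ[starRingEnd ℂ] ℂ}
    (hΦ : π.IsInvariantHermitian σ Φ) (hv : π.IsHighestWeightVector h P lam v)
    {α : Module.Dual ℂ h} (hα : α ∈ P) {e : L} (he : e ∈ rootSpace h α)
    (he0 : e ∈ (part 0 : Submodule ℂ L)) {h₀ : h} (hh₀ : (h₀ : L) = bracket e (σ.conj e)) :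
    lam h₀ ≤ 0 := by
  obtain ⟨j, hj⟩ := hv.homogeneous
  have hvv := hΦ.pos j v hj hv.ne_zero
  have hcomm := congrArg π.act (ι_mul_ι he0 (σ.conj_mem he0))
  rw [← hh₀] at hcomm
  have hcomm' := LinearMap.congr_fun hcomm v
  simp only [map_sub, map_mul, map_smul, π.act_ι, LinearMap.sub_apply, LinearMap.smul_apply,
    Module.End.mul_apply, hv.weight, hv.annihilated α hα e he, map_zero, smul_zero, sub_zero]
    at hcomm'
  have hadj := hΦ.adjoint (ι L (σ.conj e)) v (π.toLin (σ.conj e) v)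
  rw [dagger_ι_even σ (σ.conj_mem he0), σ.conj_conj, map_neg, LinearMap.neg_apply, π.act_ι,
    π.act_ι, hcomm', map_neg, map_smulₛₗ, smul_eq_mul, ← neg_mul] at hadj
  have hnn : 0 ≤ Φ (π.toLin (σ.conj e) v) (π.toLin (σ.conj e) v) := by
    by_cases h0 : π.toLin (σ.conj e) v = 0
    · simp [h0]
    · exact (hΦ.pos _ _ (π.toLin_mem (σ.conj_mem he0) hj) h0).le
  rw [hadj] at hnn
  have hre := Complex.pos_iff.1 hvv
  have h1 := Complex.nonneg_iff.1 hnn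
  simp only [Complex.mul_re, Complex.mul_im, ← hre.2, Complex.neg_re, Complex.neg_im,
    Complex.conj_re, Complex.conj_im, mul_zero, sub_zero, zero_add, neg_neg] at h1
  rw [Complex.le_def]
  refine ⟨?_, ?_⟩
  · simp only [Complex.zero_re]
    nlinarith [h1.1, hre.1]
  · rcases mul_eq_zero.1 h1.2.symm with h2 | h2
    · exact h2
    · exact absurd h2 hre.1.ne'

/-- The sign of `lam(H_α)` for a root `α` whose root vectors have adjoint `ε ad σ(X)`. -/
theorem SuperRep.IsInvariantHermitian.coroot_sign (hh : IsCartanSubalgebra h)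
    {Φ : V →ₗ[ℂ] V →ₛₗ[starRingEnd ℂ] ℂ}
    (hΦ : π.IsInvariantHermitian σ Φ) (hv : π.IsHighestWeightVector h P lam v)
    {Ψ : L →ₗ[ℂ] L →ₛₗ[starRingEnd ℂ] ℂ} (hpos : ∀ x, x ≠ 0 → 0 < Ψ x x)
    (hadj : ∀ X ∈ h, ∀ x y, Ψ (bracket X x) y = -Ψ x (bracket (σ.conj X) y))
    (hreal : ∀ x ∈ h, σ.conj x ∈ h) {α : Module.Dual ℂ h} {S : Submodule ℂ L}
    (hS0 : S ≤ part 0) (hSσ : ∀ x ∈ S, σ.conj x ∈ S) {ε : ℝ} (hε0 : ε ≠ 0)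
    (hε : ∀ X ∈ S, ∀ x y, Ψ (bracket X x) y = ε * Ψ x (bracket (σ.conj X) y))
    (hαS : rootSpace h α ≤ S) (hα : α ∈ P) (hαr : α ∈ roots h) {H : h} (hH : IsCoroot h α H) :
    0 ≤ -(ε : ℂ) * lam H := by
  obtain ⟨e, he, he0⟩ := Submodule.exists_mem_ne_zero_of_ne_bot hαr.2
  obtain ⟨h₀, hh₀, hsign, hco⟩ := exists_smul_bracket_conj_eq_coroot hh hpos hadj hreal hS0 hSσ hε
    hαS he he0
  have hlam := hΦ.bracket_conj_nonpos hv hα he (hS0 (hαS he)) hh₀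
  obtain ⟨c, rfl⟩ := hco H hH
  have h2 : c * α h₀ = 2 := by simpa using hH.1
  have hne : (h₀ : L) ≠ 0 := fun h0 => by
    have : h₀ = 0 := Subtype.ext h0
    rw [this, map_zero, mul_zero] at h2
    exact two_ne_zero h2.symm
  have hM := hpos _ hne
  have hN := hpos _ he0
  rw [Complex.pos_iff] at hM hN
  obtain ⟨m, hm⟩ : ∃ m : ℝ, Ψ h₀ h₀ = m := ⟨_, Complex.ext rfl hM.2.symm⟩
  obtain ⟨n, hn⟩ : ∃ n : ℝ, Ψ e e = n := ⟨_, Complex.ext rfl hN.2.symm⟩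
  obtain ⟨l, hl⟩ : ∃ l : ℝ, lam h₀ = l := ⟨_, Complex.ext rfl (Complex.le_def.1 hlam).2⟩
  rw [hm, Complex.ofReal_re] at hM
  rw [hn, Complex.ofReal_re] at hN
  rw [hl, ← Complex.ofReal_zero, Complex.real_le_real] at hlam
  rw [hm, hn] at hsign
  have hn0 : (n : ℂ) ≠ 0 := Complex.ofReal_ne_zero.2 hN.1.ne'
  have hm0 : (m : ℂ) ≠ 0 := Complex.ofReal_ne_zero.2 hM.1.ne'
  have hε0' : (ε : ℂ) ≠ 0 := Complex.ofReal_ne_zero.2 hε0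
  have hα₀ : α h₀ = (m / (ε * n) : ℝ) := by
    have : starRingEnd ℂ (α h₀) = (m / (ε * n) : ℝ) := by
      push_cast
      field_simp
      linear_combination -hsign
    rw [← Complex.conj_conj (α h₀), this, Complex.conj_ofReal]
  have hc : c = (2 * ε * n / m : ℝ) := by
    rw [hα₀] at h2
    push_cast at h2 ⊢
    field_simp at h2 ⊢
    linear_combination h2
  rw [map_smul, smul_eq_mul, hl, hc, ← Complex.ofReal_neg, ← Complex.ofReal_mul,
    ← Complex.ofReal_mul, Complex.zero_le_real]
  have : -ε * (2 * ε * n / m * l) = 2 * (ε * ε) * (n / m) * -l := by ring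
  rw [this]
  have := mul_self_nonneg ε
  have := (div_pos hN.1 hM.1).le
  have : 0 ≤ -l := by linarith
  positivity

end Coroots

end

end SuperHC

open SuperHC

theorem theorem3 {L : Type*} [AddCommGroup L] [Module ℂ L] [FiniteDimensional ℂ L]
    [LieSuperalgebra L] (σ : RealForm L) (D : CartanDecomposition σ)
    (h : Submodule ℂ L) (hh : IsCartanSubalgebra h) (hL : IsContragredient h)
    (hreal : ∀ x ∈ h, σ.conj x ∈ h) (hrank : h ≤ D.kC)
    (hcenter : ∃ z ∈ D.kC, z ≠ 0 ∧ ∀ x ∈ D.kC, LieSuperalgebra.bracket z x = 0)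
    (P : Set (Module.Dual ℂ h)) (hP : IsPositiveSystem h P)
    (lam : Module.Dual ℂ h)
    {V : Type*} [AddCommGroup V] [Module ℂ V] (π : SuperRep L V) (hπ : π.IsIrreducible)
    (v : V) (hv : π.IsHighestWeightVector h P lam v) :
    (π.IsUnitary σ ↔ ∀ (i : ZMod 2), ∀ a ∈ homogeneous (L := L) i,
      0 ≤ (-Complex.I) ^ i.val * evalAt lam (harishChandra hh P (adj σ a * a))) ∧
    (π.IsUnitary σ ↔ ∀ (i : ZMod 2), ∀ a ∈ homogeneous (L := L) i, π.act a v ≠ 0 →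
      0 < (-Complex.I) ^ i.val * evalAt lam (harishChandra hh P (adj σ a * a))) ∧
    (π.IsUnitary σ →
      (∀ α ∈ P, rootSpace h α ≤ D.kC → ∀ H, IsCoroot h α H → 0 ≤ lam H) ∧
      (∀ α ∈ P, rootSpace h α ≤ D.pC → ∀ H, IsCoroot h α H → lam H ≤ 0)) := by
  obtain ⟨j, hj⟩ := hv.homogeneous
  have unitary_pos : π.IsUnitary σ → ∀ (i : ZMod 2), ∀ a ∈ homogeneous (L := L) i,
      π.act a v ≠ 0 →
      0 < (-Complex.I) ^ i.val * evalAt lam (harishChandra hh P (adj σ a * a)) := by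
    intro hU i a ha h0
    obtain ⟨Φ, hΦ⟩ := SuperRep.isUnitary_iff.1 hU
    rw [hΦ.evalAt_adj_mul hh hreal hP hv ha]
    exact mul_pos (RCLike.inv_pos_of_pos (hΦ.pos j v hj hv.ne_zero))
      (hΦ.pos _ _ (π.act_mem ha hj) h0)
  have pos_nonneg : (∀ (i : ZMod 2), ∀ a ∈ homogeneous (L := L) i, π.act a v ≠ 0 →
      0 < (-Complex.I) ^ i.val * evalAt lam (harishChandra hh P (adj σ a * a))) →
      ∀ (i : ZMod 2), ∀ a ∈ homogeneous (L := L) i,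
      0 ≤ (-Complex.I) ^ i.val * evalAt lam (harishChandra hh P (adj σ a * a)) := by
    intro hpos i a ha
    by_cases h0 : π.act a v = 0
    · obtain ⟨l, hlv, hlw, -⟩ := hv.exists_coefficient hh hj
      rw [hv.evalAt_adj_mul hh hP hlv hlw σ ha, h0, map_zero, map_zero]
    · exact (hpos i a ha h0).le
  have nonneg_unitary : (∀ (i : ZMod 2), ∀ a ∈ homogeneous (L := L) i,
      0 ≤ (-Complex.I) ^ i.val * evalAt lam (harishChandra hh P (adj σ a * a))) →
      π.IsUnitary σ := fun hnn =>
    SuperRep.isUnitary_iff.2 (hv.exists_isInvariantHermitian hh hP hπ hnn)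
  refine ⟨⟨fun hU => pos_nonneg (unitary_pos hU), nonneg_unitary⟩,
    ⟨unitary_pos, fun hpos => nonneg_unitary (pos_nonneg hpos)⟩, fun hU => ?_⟩
  obtain ⟨Φ, hΦ⟩ := SuperRep.isUnitary_iff.1 hU
  obtain ⟨Ψ, hΨpos, hk, hp⟩ := D.exists_hermitian
  have hroots : P ⊆ roots h := by
    obtain ⟨φ, -, rfl⟩ := hP
    exact fun α hα => hα.1
  have span_le : ∀ S : Submodule ℝ L, S ≤ σ.even →
      Submodule.span ℂ (S : Set L) ≤ LieSuperalgebra.part 0 := fun S hS =>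
    Submodule.span_le.2 fun x hx => (hS hx).2
  refine ⟨fun α hα hαk H hH => ?_, fun α hα hαp H hH => ?_⟩
  · have := hΦ.coroot_sign hh hv hΨpos (fun X hX => hk X (hrank hX)) hreal
      (span_le _ D.k_le_even)
      (fun x hx => RealForm.conj_mem_span (D.k_le_even.trans inf_le_left) hx)
      (ε := -1) (by norm_num) (fun X hX x y => by rw [hk X hX]; simp) hαk hα (hroots hα) hH
    simpa using this
  · have := hΦ.coroot_sign hh hv hΨpos (fun X hX => hk X (hrank hX)) hreal
      (span_le _ D.p_le_even)
      (fun x hx => RealForm.conj_mem_span (D.p_le_even.trans inf_le_left) hx)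
      (ε := 1) (by norm_num) (fun X hX x y => by rw [hp X hX]; simp) hαp hα (hroots hα) hH
    simpa using this
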